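/- **Setting.** A layered MDP $M$ with horizon $H$ has a finite state space $\mathcal X=\mathcal X_1\sqcup\dots\sqcup\mathcal X_H$, an action set $\mathcal A$, an initial distribution $\rho$ on $\mathcal X_1$, transitions $T(\cdot\mid x,a)$ from $\mathcal X_h$ to $\mathcal X_{h+1}$ ($h<H$), and reward distributions $r(x,a)$ on $[-1,1]$. For a policy $\pi:\mathcal X\to\Delta(\mathcal A)$ let $d_h^\pi(x,a)$ be the state-action occupancy measure of layer $h$, $Q^\pi(x,a)$ the expected total reward from $(x,a)$ to the end of the episode under $\pi$, and $V^\pi(\rho)$ the expected total reward of an episode. An offline policy evaluation (OPE) problem is a tuple $\mathfrak g=(M,\pi_e,\mu,\mathcal F)$, where $\pi_e$ is a deterministic evaluation policy, $\mu_h\in\Delta(\mathcal X_h\times\mathcal A)$ for $h\in[H]$, and $\mathcal F$ is a set of pairs $(f,w)$ with $f:\mathcal X\times\mathcal A\to[-1,1]$ and $w:[H]\to\mathbb R$. It is *realizable* if $(Q^{\pi_e},W)\in\mathcal F$, where $W(h)=\sum_{x\in\mathcal X_h}\mu_h(x,\pi_e(x))\,Q^{\pi_e}(x,\pi_e(x))$,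 and *admissible* if there is a policy $\pi_b$ with $\mu_h=d_h^{\pi_b}$ for all $h\in[H]$. The concentrability coefficient of $\pi$ is $\max_h\max_{x\in\mathcal X_h,a}d_h^\pi(x,a)/\mu_h(x,a)$ (with $0/0=0$). One offline sample consists of independent tuples $(x_h,a_h,r_h,x_{h+1}')$, one for each $h\in[H-1]$, with $(x_h,a_h)\sim\mu_h$, $r_h\sim r(x_h,a_h)$, $x_{h+1}'\sim T(\cdot\mid x_h,a_h)$. **Theorem.** There are universal constants $c,c'>0$ and $k,H_0\in\mathbb N$ such that for every $0<\epsilon\le 1/15$ and every $H\ge1$ there is a class $\mathfrak G$ of OPE problems with horizon $H$ and binary actions $\mathcal A=\{\mathfrak a_1,\mathfrak a_2\}$, all sharing the same layered state space, the same evaluation policy $\pi_e\equiv\mathfrak a_1$ and the same class $\mathcal F$, with the following properties. 1. $|\mathcal F|=2$, and the two members of $\mathcal F$ have different first components. 2. Every $\mathfrak g\in\mathfrak G$ is realizable and admissible, and the concentrability coefficient of every policy (in particular of $\pi_e$) with respect to $\mu^{\mathfrak g}$ is at most $384H^3$. If $H\ge2$, the (unobserved) rewards in the last layer have mean $0$.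 3. Let $\widehat V$ be any (possibly randomized) estimator, which may depend on $\mathfrak G$, that takes $n$ i.i.d. offline samples and satisfies $\mathbb E_{\mathfrak g}\big|\widehat V-V^{\pi_e}(\rho;M^{\mathfrak g})\big|\le\epsilon$ for every $\mathfrak g\in\mathfrak G$. Then $$n\;\ge\;\frac{c\,H2^H/\epsilon}{\big(\log (H2^H/\epsilon)\big)^{k}},\qquad\text{that is, } n=\widetilde\Omega\!\left(\frac{H2^H}{\epsilon}\right),$$ and $n\ge 2^{c'H}$ whenever $H\ge H_0$, that is, $n=2^{\Omega(H)}$. -/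

import Mathlib

open MeasureTheory ProbabilityTheory
open scoped ENNReal

/-- A finite-horizon layered Markov decision process with finite state space `X`, action space `A`
and horizon `H`. Layers are indexed by `Fin H` (layer `0` is the first one). The value of `trans`
on the last layer plays no role. Rewards are drawn from a distribution on `[-1, 1]`. -/
structure MDP (X A : Type) (H : ℕ) where
  layer : X → Fin H
  init : PMF X
  trans : X → A → PMF X
  reward : X → A → ProbabilityMeasure (Set.Icc (-1 : ℝ) 1)
  init_layer : ∀ x ∈ init.support, (layer x : ℕ) = 0
  trans_layer : ∀ x a, (layer x : ℕ) + 1 < H →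
    ∀ x' ∈ (trans x a).support, (layer x' : ℕ) = (layer x : ℕ) + 1

/-- Markov policies. Since the state space is layered, they may be non-stationary. -/
abbrev Policy (X A : Type) := X → PMF A

namespace MDP

variable {X A : Type} {H : ℕ}

/-- The deterministic policy given by a map from states to actions. -/
noncomputable def detPolicy (f : X → A) : Policy X A := fun x => PMF.pure (f x)

/-- The law of `(x, a)` where `x` has law `ν` and `a` has law `π(· | x)`. -/
noncomputable def act (π : Policy X A) (ν : PMF X) : PMF (X × A) :=
  ν.bind fun x => (π x).map fun a => (x, a)

/-- The law of the state-action pair reached after `j` steps of the process driven by `π`,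
when the current state-action pair has law `q`. -/
noncomputable def pairLaw (M : MDP X A H) (π : Policy X A) (q : PMF (X × A)) : ℕ → PMF (X × A)
  | 0 => q
  | j + 1 => act π ((pairLaw M π q j).bind fun p => M.trans p.1 p.2)

/-- State occupancy measure `d_h^π(x)` of layer `h`. -/
noncomputable def stateOcc (M : MDP X A H) (π : Policy X A) (h : Fin H) (x : X) : ℝ≥0∞ :=
  (M.pairLaw π (act π M.init) h).map Prod.fst x

/-- State-action occupancy measure `d_h^π(x, a) = d_h^π(x) π(a | x)`. -/
noncomputable def occ (M : MDP X A H) (π : Policy X A) (h : Fin H) (x : X) (a : A) : ℝ≥0∞ :=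
  M.stateOcc π h x * π x a

/-- The expected reward `r(x, a)`. -/
noncomputable def meanReward (M : MDP X A H) (x : X) (a : A) : ℝ :=
  ∫ r, (r : ℝ) ∂(M.reward x a : Measure (Set.Icc (-1 : ℝ) 1))

/-- Expected cumulative reward over `m` steps, when the first state-action pair has law `q`
and later actions follow `π`. -/
noncomputable def expReturn [Fintype X] [Fintype A] (M : MDP X A H) (π : Policy X A)
    (q : PMF (X × A)) (m : ℕ) : ℝ :=
  ∑ j ∈ Finset.range m, ∑ p : X × A, (M.pairLaw π q j p).toReal * M.meanReward p.1 p.2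

/-- State-action value function: the expected reward collected from `(x, a)` to the end of the
episode. -/
noncomputable def Q [Fintype X] [Fintype A] (M : MDP X A H) (π : Policy X A) (x : X) (a : A) : ℝ :=
  M.expReturn π (PMF.pure (x, a)) (H - (M.layer x : ℕ))

/-- State value function: the expected reward collected from `x` to the end of the episode. -/
noncomputable def V [Fintype X] [Fintype A] (M : MDP X A H) (π : Policy X A) (x : X) : ℝ :=
  M.expReturn π (act π (PMF.pure x)) (H - (M.layer x : ℕ))

/-- The value of `π` for the initial distribution. -/
noncomputable def value [Fintype X] [Fintype A] (M : MDP X A H) (π : Policy X A) : ℝ :=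
  ∑ x, (M.init x).toReal * M.V π x

/-- The concentrability coefficient of `π` with respect to `μ`: the largest ratio
`d_h^π(x, a) / μ_h(x, a)`. In `ℝ≥0∞`, `0 / 0 = 0` and `t / 0 = ∞` for `t ≠ 0`. -/
noncomputable def concentrability (M : MDP X A H) (μ : Fin H → PMF (X × A)) (π : Policy X A) :
    ℝ≥0∞ :=
  ⨆ (h : Fin H) (x : X) (_ : M.layer x = h) (a : A), M.occ π h x a / μ h (x, a)

/-- The `W`-function of a deterministic policy `f` with respect to `μ`:
`W(h) = ∑_{x ∈ X_h} μ_h(x, f(x)) Q_h(x, f(x))`. -/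
noncomputable def W [Fintype X] [Fintype A] (M : MDP X A H) (μ : Fin H → PMF (X × A)) (f : X → A)
    (h : Fin H) : ℝ :=
  ∑ x with M.layer x = h, (μ h (x, f x)).toReal * M.Q (detPolicy f) x (f x)

end MDP

/-- An offline policy evaluation problem: an MDP `M`, a deterministic evaluation policy `πe`, an
offline distribution `μ_h` on `X_h × A` for each layer, and a class `F` whose members are
pairs of a function `X × A → [-1, 1]` and a function of the layer (the candidate values of the
`Q`-function and the `W`-function of `πe`). -/
structure OPEProblem (X A : Type) (H : ℕ) where
  M : MDP X A H
  πe : X → A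
  μ : Fin H → PMF (X × A)
  F : Set ((X → A → ℝ) × (Fin H → ℝ))
  μ_layer : ∀ h, ∀ p ∈ (μ h).support, M.layer p.1 = h
  F_mem : ∀ f ∈ F, ∀ x a, f.1 x a ∈ Set.Icc (-1 : ℝ) 1

/-- A tuple `(x, a, r, x')`. -/
abbrev Transition (X A : Type) := X × A × Set.Icc (-1 : ℝ) 1 × X

/-- `n` offline samples; each consists of one tuple for every layer but the last. -/
abbrev Dataset (X A : Type) (H n : ℕ) := Fin n → Fin (H - 1) → Transition X A

namespace OPEProblem

variable {X A : Type} {H : ℕ}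

/-- `F` contains the pair of the `Q`-function and the `W`-function of the evaluation policy. -/
def Realizable [Fintype X] [Fintype A] (g : OPEProblem X A H) : Prop :=
  (g.M.Q (MDP.detPolicy g.πe), g.M.W g.μ g.πe) ∈ g.F

/-- The offline distribution is the occupancy measure of some policy. -/
def Admissible (g : OPEProblem X A H) : Prop :=
  ∃ πb : Policy X A, ∀ h x a, g.μ h (x, a) = g.M.occ πb h x a

variable [MeasurableSpace X] [MeasurableSpace A]

/-- The law of the tuple of layer `h`: `(x, a) ∼ μ_h`, then independently `r ∼ r(x, a)` and
`x' ∼ T(· | x, a)`. -/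
noncomputable def transitionLaw (g : OPEProblem X A H) (h : Fin H) : Measure (Transition X A) :=
  (g.μ h).toMeasure.bind fun p =>
    ((g.M.reward p.1 p.2 : Measure (Set.Icc (-1 : ℝ) 1)).prod
      (g.M.trans p.1 p.2).toMeasure).map fun s => (p.1, p.2, s.1, s.2)

/-- The law of `n` independent offline samples. Within a sample, the tuples of the different layers
are independent. -/
noncomputable def dataLaw (g : OPEProblem X A H) (n : ℕ) : Measure (Dataset X A H n) :=
  Measure.pi fun _ => Measure.pi fun h : Fin (H - 1) =>
    g.transitionLaw (h.castLE (Nat.sub_le H 1))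

/-- The expected absolute error, on the problem `g`, of a (possibly randomized) estimator of the
value of the evaluation policy. -/
noncomputable def expectedError [Fintype X] [Fintype A] (g : OPEProblem X A H) {n : ℕ}
    (est : Kernel (Dataset X A H n) ℝ) : ℝ≥0∞ :=
  ∫⁻ D, ∫⁻ v, ENNReal.ofReal |v - g.M.value (MDP.detPolicy g.πe)| ∂(est D) ∂(g.dataLaw n)

instance [Fintype X] [Fintype A] [DiscreteMeasurableSpace X] [DiscreteMeasurableSpace A]
    (g : OPEProblem X A H) (h : Fin H) : IsProbabilityMeasure (g.transitionLaw h) := by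
  constructor
  unfold transitionLaw
  rw [Measure.bind_apply MeasurableSet.univ (Measurable.of_discrete).aemeasurable]
  have hone : ∀ p : X × A, (((g.M.reward p.1 p.2 : Measure (Set.Icc (-1 : ℝ) 1)).prod
      (g.M.trans p.1 p.2).toMeasure).map
        fun s => ((p.1, p.2, s.1, s.2) : Transition X A)) Set.univ = 1 := by
    intro p
    rw [Measure.map_apply (by fun_prop) MeasurableSet.univ]
    simp
  simp [hone]

end OPEProblem

/-! Each problem is a block MDP with two hidden latent states, good and bad. A hidden state is
observed as a uniform block number together with a bit, and the bit is read through an unknown key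
`ψ` of that block. A sign `σ` determines the value: the evaluation policy has value `2 * ε` or `-2 *
ε`. In both hidden states of layer `h` the evaluation action has value `sgn σ * val H h`. So neither
the value function nor the `W`-function depends on the keys, and two candidates make every problem
realizable.

Under the evaluation action, a good state goes to the bad state with probability `stay H`, and
otherwise to a visible state with reward `1` or `-1`. A bad state always goes to one of these
visible states. Both splits depend on `σ`, but in opposite directions. When bad mass is `badRatio H
h` times good mass, as in the offline data, the biases cancel (`latentWeight_add`). The other action
keeps the hidden state with probability `1 / 2` and otherwise absorbs. The parameter `expl H` is
tuned so that the behaviour policy maintains these ratios (`expl_mul_stay`, `toReal_offlineLaw`).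

If no block occurs twice in the data, the tuples depend on disjoint sets of keys. Averaging over
uniform keys then factorizes (`DependsOn.sum_prod`), and each factor is independent of `σ`
(`sum_tup_eq`). The sign can be seen directly only in a reward at a hidden state of layer `H - 2`,
which a sample visits with probability at most `12 * ε * (1 / 2) ^ (H - 2)`. Repeated blocks become
negligible as the number of blocks grows. So for `n < 2 ^ H / (384 * ε)` a data set is `Blind` with
probability at least `3 / 4`. On such data the errors for the two signs add up to at least `4 * ε`,
which contradicts an expected error of at most `ε` for both signs (`not_forall_expectedError_le`).

Concentrability stays polynomial because the potential 2·good + bad at least halves in expectation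
at every step, whatever the action (`expect_potential_le`). No policy therefore reaches hidden
states much more often than the behaviour policy does. -/

/-! ### Expectations under probability mass functions on finite types -/

namespace PMF

variable {α β : Type}

/-- The expectation of a real function under a probability mass function on a finite type. -/
noncomputable def expect [Fintype α] (p : PMF α) (v : α → ℝ) : ℝ := ∑ x, (p x).toReal * v x

theorem sum_toReal [Fintype α] (p : PMF α) : ∑ x, (p x).toReal = 1 := by
  rw [← ENNReal.toReal_sum fun x _ => p.apply_ne_top x, ← tsum_fintype (L := .unconditional _),
    p.tsum_coe, ENNReal.toReal_one]

theorem toReal_bind_apply [Fintype α] (p : PMF α) (f : α → PMF β) (y : β) :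
    (p.bind f y).toReal = ∑ x, (p x).toReal * (f x y).toReal := by
  rw [bind_apply, tsum_fintype, ENNReal.toReal_sum]
  · simp
  · exact fun x _ => ENNReal.mul_ne_top (p.apply_ne_top x) ((f x).apply_ne_top y)

theorem bind_congr' {γ : Type} (p : PMF α) {f g : α → PMF γ} (h : ∀ x, p x ≠ 0 → f x = g x) :
    p.bind f = p.bind g := by
  ext y
  rw [bind_apply, bind_apply]
  refine tsum_congr fun x => ?_
  by_cases hx : p x = 0
  · simp [hx]
  · rw [h x hx]

variable [Fintype α] [Fintype β]

theorem expect_bind (p : PMF α) (f : α → PMF β) (v : β → ℝ) :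
    (p.bind f).expect v = p.expect fun x => (f x).expect v := by
  simp only [expect, toReal_bind_apply, Finset.sum_mul, Finset.mul_sum]
  rw [Finset.sum_comm]
  simp only [mul_assoc]

theorem expect_pure (a : α) (v : α → ℝ) : (PMF.pure a).expect v = v a := by
  classical
  simp [expect, pure_apply, apply_ite ENNReal.toReal, ite_mul]

theorem expect_map (p : PMF α) (f : α → β) (v : β → ℝ) :
    (p.map f).expect v = p.expect (v ∘ f) := by
  rw [← bind_pure_comp, expect_bind]
  simp [expect_pure, Function.comp_def]

theorem expect_mono (p : PMF α) {v w : α → ℝ} (h : ∀ x, p x ≠ 0 → v x ≤ w x) :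
    p.expect v ≤ p.expect w := by
  refine Finset.sum_le_sum fun x _ => ?_
  by_cases hx : p x = 0
  · simp [hx]
  · exact mul_le_mul_of_nonneg_left (h x hx) ENNReal.toReal_nonneg

theorem expect_congr (p : PMF α) {v w : α → ℝ} (h : ∀ x, p x ≠ 0 → v x = w x) :
    p.expect v = p.expect w :=
  le_antisymm (p.expect_mono fun x hx => (h x hx).le) (p.expect_mono fun x hx => (h x hx).ge)

theorem expect_const (p : PMF α) (c : ℝ) : (p.expect fun _ => c) = c := by
  rw [expect, ← Finset.sum_mul, sum_toReal, one_mul]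

theorem expect_le (p : PMF α) {v : α → ℝ} {c : ℝ} (h : ∀ x, p x ≠ 0 → v x ≤ c) :
    p.expect v ≤ c :=
  (p.expect_mono h).trans_eq (p.expect_const c)

theorem expect_add (p : PMF α) (v w : α → ℝ) :
    (p.expect fun x => v x + w x) = p.expect v + p.expect w := by
  simp [expect, mul_add, Finset.sum_add_distrib]

theorem toMeasure_setOf [MeasurableSpace α] [DiscreteMeasurableSpace α] (p : PMF α)
    (P : α → Prop) [DecidablePred P] :
    p.toMeasure {x | P x} = ENNReal.ofReal (p.expect fun x => if P x then 1 else 0) := by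
  rw [toMeasure_apply_fintype, expect,
    ENNReal.ofReal_sum_of_nonneg fun x _ => mul_nonneg ENNReal.toReal_nonneg (by split_ifs <;> simp)]
  refine Finset.sum_congr rfl fun x _ => ?_
  by_cases hx : P x <;> simp [hx, ENNReal.ofReal_toReal (p.apply_ne_top x)]

/-- The probability mass function with the given real weights (and a junk value if these do not
form a probability vector). -/
noncomputable def ofWeights [DecidableEq α] (d : α) (w : α → ℝ) : PMF α :=
  open Classical in
  if h : (∀ x, 0 ≤ w x) ∧ ∑ x, w x = 1 then
    PMF.ofFintype (fun x => ENNReal.ofReal (w x))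
      (by rw [← ENNReal.ofReal_sum_of_nonneg fun x _ => h.1 x, h.2, ENNReal.ofReal_one])
  else PMF.pure d

theorem toReal_ofWeights [DecidableEq α] (d : α) {w : α → ℝ} (h0 : ∀ x, 0 ≤ w x)
    (h1 : ∑ x, w x = 1) (x : α) : (ofWeights d w x).toReal = w x := by
  rw [ofWeights, dif_pos ⟨h0, h1⟩, PMF.ofFintype_apply, ENNReal.toReal_ofReal (h0 x)]

theorem expect_ofWeights [DecidableEq α] (d : α) {w : α → ℝ} (h0 : ∀ x, 0 ≤ w x)
    (h1 : ∑ x, w x = 1) (v : α → ℝ) : (ofWeights d w).expect v = ∑ x, w x * v x := by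
  simp only [expect, toReal_ofWeights d h0 h1]

end PMF

/-! ### Markov decision processes -/

namespace MDP

variable {X A : Type} {H : ℕ}

theorem act_apply (π : Policy X A) (ν : PMF X) (x : X) (a : A) :
    act π ν (x, a) = ν x * π x a := by
  classical
  rw [act, PMF.bind_apply, tsum_eq_single x]
  · rw [PMF.map_apply, tsum_eq_single a]
    · simp
    · intro b hb
      simp [hb.symm]
  · intro y hy
    have : (PMF.map (fun a => (y, a)) (π y)) (x, a) = 0 := by
      rw [PMF.map_apply, ENNReal.tsum_eq_zero]
      intro b
      simp [hy.symm]
    rw [this, mul_zero]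

theorem map_fst_act (π : Policy X A) (ν : PMF X) : (act π ν).map Prod.fst = ν := by
  rw [act, PMF.map_bind]
  conv_rhs => rw [← PMF.bind_pure ν]
  congr 1
  ext1 x
  rw [PMF.map_comp]
  exact PMF.map_const _ _

theorem act_detPolicy_pure (f : X → A) (x : X) :
    act (detPolicy f) (PMF.pure x) = PMF.pure (x, f x) := by
  rw [act, PMF.pure_bind, detPolicy, PMF.pure_map]

/-- The law of the state reached after `j` steps. -/
noncomputable def stateLaw (M : MDP X A H) (π : Policy X A) : ℕ → PMF X
  | 0 => M.init
  | j + 1 => (act π (stateLaw M π j)).bind fun p => M.trans p.1 p.2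

theorem pairLaw_act_init (M : MDP X A H) (π : Policy X A) (j : ℕ) :
    M.pairLaw π (act π M.init) j = act π (M.stateLaw π j) := by
  induction j with
  | zero => rfl
  | succ j ih => rw [pairLaw, ih, stateLaw]

theorem stateOcc_eq (M : MDP X A H) (π : Policy X A) (h : Fin H) (x : X) :
    M.stateOcc π h x = M.stateLaw π h x := by
  rw [stateOcc, pairLaw_act_init, map_fst_act]

theorem occ_eq (M : MDP X A H) (π : Policy X A) (h : Fin H) (x : X) (a : A) :
    M.occ π h x a = M.stateLaw π h x * π x a := by
  rw [occ, stateOcc_eq]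

theorem layer_of_stateLaw_ne_zero (M : MDP X A H) (π : Policy X A) {j : ℕ} (hj : j < H) {x : X}
    (hx : M.stateLaw π j x ≠ 0) : (M.layer x : ℕ) = j := by
  induction j generalizing x with
  | zero => exact M.init_layer x hx
  | succ j ih =>
    rw [stateLaw, ← PMF.mem_support_iff, PMF.mem_support_bind_iff] at hx
    obtain ⟨⟨y, a⟩, hy, hyx⟩ := hx
    rw [PMF.mem_support_iff, act_apply] at hy
    have := ih (by omega) (left_ne_zero_of_mul hy)
    rw [M.trans_layer y a (by omega) x hyx, this]

/-- The definition peels off the last step; the Bellman recursion needs the first one. -/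
theorem pairLaw_succ' (M : MDP X A H) (π : Policy X A) (q : PMF (X × A)) (j : ℕ) :
    M.pairLaw π q (j + 1) = M.pairLaw π (act π (q.bind fun p => M.trans p.1 p.2)) j := by
  induction j generalizing q with
  | zero => rfl
  | succ j ih => rw [pairLaw, ih]; rfl

theorem pairLaw_bind {ι : Type} (M : MDP X A H) (π : Policy X A) (r : PMF ι)
    (q : ι → PMF (X × A)) (j : ℕ) :
    M.pairLaw π (r.bind q) j = r.bind fun i => M.pairLaw π (q i) j := by
  induction j with
  | zero => rfl
  | succ j ih => simp only [pairLaw, ih, act, PMF.bind_bind]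

variable [Fintype X] [Fintype A]

theorem expReturn_eq (M : MDP X A H) (π : Policy X A) (q : PMF (X × A)) (m : ℕ) :
    M.expReturn π q m =
      ∑ j ∈ Finset.range m, (M.pairLaw π q j).expect fun p => M.meanReward p.1 p.2 := rfl

theorem expReturn_bind {ι : Type} [Fintype ι] (M : MDP X A H) (π : Policy X A) (r : PMF ι)
    (q : ι → PMF (X × A)) (m : ℕ) :
    M.expReturn π (r.bind q) m = r.expect fun i => M.expReturn π (q i) m := by
  simp only [expReturn_eq, pairLaw_bind, PMF.expect_bind]
  simp only [PMF.expect, Finset.mul_sum]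
  rw [Finset.sum_comm]

theorem expReturn_succ (M : MDP X A H) (π : Policy X A) (q : PMF (X × A)) (m : ℕ) :
    M.expReturn π q (m + 1) = (q.expect fun p => M.meanReward p.1 p.2) +
      M.expReturn π (act π (q.bind fun p => M.trans p.1 p.2)) m := by
  rw [expReturn_eq, Finset.sum_range_succ', add_comm]
  simp only [pairLaw_succ']
  rfl

theorem expReturn_detPolicy_succ (M : MDP X A H) (f : X → A) (x : X) (a : A) (m : ℕ) :
    M.expReturn (detPolicy f) (PMF.pure (x, a)) (m + 1) = M.meanReward x a +
      (M.trans x a).expect fun y => M.expReturn (detPolicy f) (PMF.pure (y, f y)) m := by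
  rw [expReturn_succ, PMF.expect_pure, PMF.pure_bind, ← expReturn_bind]
  congr 2
  rw [act]
  congr 1
  ext1 y
  rw [detPolicy, PMF.pure_map]

/-- The Bellman equations determine the state-action value function of a deterministic policy. -/
theorem Q_eq_of_bellman (M : MDP X A H) (π : X → A) (f : X → A → ℝ)
    (hlast : ∀ x a, (M.layer x : ℕ) + 1 = H → f x a = M.meanReward x a)
    (hstep : ∀ x a, (M.layer x : ℕ) + 1 < H →
      f x a = M.meanReward x a + (M.trans x a).expect fun y => f y (π y)) :
    M.Q (detPolicy π) = f := by
  have key : ∀ m x a, (M.layer x : ℕ) + (m + 1) = H →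
      M.expReturn (detPolicy π) (PMF.pure (x, a)) (m + 1) = f x a := by
    intro m
    induction m with
    | zero =>
      intro x a hx
      rw [expReturn_detPolicy_succ, hlast x a hx]
      simp [expReturn, PMF.expect]
    | succ m ih =>
      intro x a hx
      rw [expReturn_detPolicy_succ, hstep x a (by omega)]
      congr 1
      refine PMF.expect_congr _ fun y hy => ih y _ ?_
      have := M.trans_layer x a (by omega) y hy
      omega
  funext x a
  have hx := (M.layer x).isLt
  have := key (H - (M.layer x : ℕ) - 1) x a (by omega)
  rwa [Nat.sub_add_cancel (by omega)] at this

theorem value_detPolicy (M : MDP X A H) (π : X → A) :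
    M.value (detPolicy π) = M.init.expect fun x => M.Q (detPolicy π) x (π x) := by
  simp only [value, PMF.expect, V, Q, act_detPolicy_pure]

end MDP

/-! ### Block MDPs -/

/-- A layered MDP with deterministic rewards on latent states; transitions and rewards depend on
the time step. -/
structure LatentModel (Λ A : Type) where
  init : PMF Λ
  trans : ℕ → Λ → A → PMF Λ
  reward : ℕ → Λ → A → Set.Icc (-1 : ℝ) 1

namespace LatentModel

variable {Λ S A : Type}

/-- The block MDP in which the latent state `l` emits an observation of law `emit l`, from which
it is recovered by `lab`. -/
noncomputable def blockMDP (P : LatentModel Λ A) (lab : S → Λ) (emit : Λ → PMF S) (H : ℕ)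
    [NeZero H] : MDP (Fin H × S) A H where
  layer := Prod.fst
  init := (P.init.bind emit).map fun s => (Fin.ofNat H 0, s)
  trans x a := ((P.trans x.1 (lab x.2) a).bind emit).map fun s => (Fin.ofNat H (x.1 + 1), s)
  reward x a := ⟨Measure.dirac (P.reward x.1 (lab x.2) a), inferInstance⟩
  init_layer x hx := by
    obtain ⟨s, -, rfl⟩ := (PMF.mem_support_map_iff _ _ _).1 hx
    simp
  trans_layer x a hxa y hy := by
    obtain ⟨s, -, rfl⟩ := (PMF.mem_support_map_iff _ _ _).1 hy
    exact Nat.mod_eq_of_lt hxa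

theorem meanReward_blockMDP (P : LatentModel Λ A) (lab : S → Λ) (emit : Λ → PMF S) (H : ℕ)
    [NeZero H] (x : Fin H × S) (a : A) :
    (P.blockMDP lab emit H).meanReward x a = P.reward x.1 (lab x.2) a := by
  simp [MDP.meanReward, blockMDP]

/-- The law of the latent state after `j` steps, for a policy that may use the observations. -/
noncomputable def latentLaw (P : LatentModel Λ A) (emit : Λ → PMF S) (π : ℕ → S → PMF A) : ℕ → PMF Λ
  | 0 => P.init
  | j + 1 => (latentLaw P emit π j).bind fun l => (emit l).bind fun s => (π j s).bind (P.trans j l)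

/-- A policy may read observations, but the label recovers the latent state on the support of the
emission. Transitions therefore see only the latent state, and each new observation is freshly
emitted. -/
theorem stateLaw_blockMDP (P : LatentModel Λ A) {lab : S → Λ} {emit : Λ → PMF S}
    (hemit : ∀ l s, emit l s ≠ 0 → lab s = l) {H : ℕ} [NeZero H] (π : Policy (Fin H × S) A)
    {j : ℕ} (hj : j < H) :
    (P.blockMDP lab emit H).stateLaw π j =
      ((P.latentLaw emit (fun i s => π (Fin.ofNat H i, s)) j).bind emit).map
        fun s => (Fin.ofNat H j, s) := by
  induction j with
  | zero => rfl
  | succ j ih =>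
    have hval : ((Fin.ofNat H j : Fin H) : ℕ) = j := Nat.mod_eq_of_lt (by omega)
    rw [MDP.stateLaw, ih (by omega), latentLaw, MDP.act]
    simp only [PMF.bind_bind, PMF.bind_map, PMF.map_bind, Function.comp_def]
    congr 1
    funext l
    refine PMF.bind_congr' _ fun s hs => ?_
    congr 1
    funext a
    simp only [blockMDP, hval, hemit l s hs, PMF.map_bind]

theorem latentLaw_succ_of_label (P : LatentModel Λ A) {lab : S → Λ} {emit : Λ → PMF S}
    (hemit : ∀ l s, emit l s ≠ 0 → lab s = l) (pol : Λ → PMF A) (j : ℕ) :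
    P.latentLaw emit (fun _ s => pol (lab s)) (j + 1) =
      (P.latentLaw emit (fun _ s => pol (lab s)) j).bind fun l => (pol l).bind (P.trans j l) := by
  rw [latentLaw]
  congr 1
  funext l
  rw [PMF.bind_congr' (g := fun _ => (pol l).bind (P.trans j l)) (emit l)
    fun s hs => by rw [hemit l s hs], PMF.bind_const]

theorem bind_emit_apply {lab : S → Λ} {emit : Λ → PMF S} (hemit : ∀ l s, emit l s ≠ 0 → lab s = l)
    (p : PMF Λ) (s : S) : p.bind emit s = p (lab s) * emit (lab s) s := by
  rw [PMF.bind_apply, tsum_eq_single (lab s)]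
  intro l hl
  by_cases h : emit l s = 0
  · rw [h, mul_zero]
  · exact absurd (hemit l s h).symm hl

theorem stateLaw_blockMDP_apply (P : LatentModel Λ A) {lab : S → Λ} {emit : Λ → PMF S}
    (hemit : ∀ l s, emit l s ≠ 0 → lab s = l) {H : ℕ} [NeZero H] (π : Policy (Fin H × S) A)
    (h : Fin H) (s : S) :
    (P.blockMDP lab emit H).stateLaw π h (h, s) =
      P.latentLaw emit (fun i s => π (Fin.ofNat H i, s)) h (lab s) * emit (lab s) s := by
  classical
  have hh : (Fin.ofNat H h : Fin H) = h := by simp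
  rw [stateLaw_blockMDP P hemit π h.isLt, PMF.map_apply, tsum_eq_single s, hh, if_pos rfl,
    bind_emit_apply hemit]
  intro t ht
  rw [if_neg fun e => ht (Prod.ext_iff.1 e).2.symm]

variable [Fintype Λ] [Fintype S] [Fintype A]

/-- A potential that does not increase in expectation, whatever the action, gives a bound on the
latent law of every policy. -/
theorem expect_latentLaw_succ_le (P : LatentModel Λ A) (emit : Λ → PMF S) (π : ℕ → S → PMF A)
    {j : ℕ} {v w : Λ → ℝ} (h : ∀ l a, (P.trans j l a).expect w ≤ v l) :
    (P.latentLaw emit π (j + 1)).expect w ≤ (P.latentLaw emit π j).expect v := by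
  rw [latentLaw, PMF.expect_bind]
  refine PMF.expect_mono _ fun l _ => ?_
  rw [PMF.expect_bind]
  refine PMF.expect_le _ fun s _ => ?_
  rw [PMF.expect_bind]
  exact PMF.expect_le _ fun a _ => h l a

theorem expect_bind_emit {lab : S → Λ} {emit : Λ → PMF S} (hemit : ∀ l s, emit l s ≠ 0 → lab s = l)
    (p : PMF Λ) (v : Λ → ℝ) : ((p.bind emit).expect fun s => v (lab s)) = p.expect v := by
  rw [PMF.expect_bind]
  refine PMF.expect_congr _ fun l _ => ?_
  rw [PMF.expect_congr (w := fun _ => v l) _ fun s hs => by rw [hemit l s hs], PMF.expect_const]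

/-- The state-action value function of a block MDP, from the latent Bellman equations. -/
theorem Q_blockMDP (P : LatentModel Λ A) {lab : S → Λ} {emit : Λ → PMF S}
    (hemit : ∀ l s, emit l s ≠ 0 → lab s = l) {H : ℕ} [NeZero H] (a₀ : A) (f : ℕ → Λ → A → ℝ)
    (hlast : ∀ j l a, j + 1 = H → f j l a = P.reward j l a)
    (hstep : ∀ j l a, j + 1 < H →
      f j l a = P.reward j l a + (P.trans j l a).expect fun l' => f (j + 1) l' a₀) :
    (P.blockMDP lab emit H).Q (MDP.detPolicy fun _ => a₀) = fun x a => f x.1 (lab x.2) a := by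
  refine MDP.Q_eq_of_bellman _ _ _ (fun x a hx => ?_) fun x a hx => ?_
  · exact (hlast _ _ _ hx).trans (P.meanReward_blockMDP lab emit H x a).symm
  · refine (hstep _ _ _ hx).trans ?_
    rw [meanReward_blockMDP]
    congr 1
    simp only [blockMDP, PMF.expect_map, Function.comp_def]
    rw [expect_bind_emit hemit _ fun l' => f _ l' a₀]
    have hval : ((Fin.ofNat H (x.1 + 1) : Fin H) : ℕ) = x.1 + 1 := Nat.mod_eq_of_lt hx
    rw [hval]

end LatentModel

/-! ### Offline data of block MDPs -/

namespace OPEProblem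

variable {X A Y : Type} {H : ℕ} [Fintype X] [Fintype A] [MeasurableSpace X] [MeasurableSpace A]
  [Fintype Y] [MeasurableSpace Y] [DiscreteMeasurableSpace Y]

/-- The expected error of an estimator, when the offline tuples take finitely many values. -/
theorem expectedError_eq_sum (g : OPEProblem X A H) (p : Fin (H - 1) → PMF Y)
    (emb : Fin (H - 1) → Y → Transition X A)
    (hg : ∀ h : Fin (H - 1), g.transitionLaw (h.castLE (Nat.sub_le H 1)) =
      (p h).toMeasure.map (emb h)) {n : ℕ} (est : Kernel (Dataset X A H n) ℝ) :
    g.expectedError est = ∑ D : Fin n → Fin (H - 1) → Y, (∏ k, ∏ h, p h (D k h)) *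
      ∫⁻ v, ENNReal.ofReal |v - g.M.value (MDP.detPolicy g.πe)| ∂(est fun k h => emb h (D k h)) := by
  have hm : ∀ h, Measurable (emb h) := fun h => Measurable.of_discrete
  have hlaw : g.dataLaw n = (Measure.pi fun _ : Fin n => Measure.pi fun h => (p h).toMeasure).map
      fun D k h => emb h (D k h) := by
    rw [dataLaw]
    simp only [hg]
    have h1 : (Measure.pi fun h => (p h).toMeasure.map (emb h)) =
        (Measure.pi fun h => (p h).toMeasure).map fun d h => emb h (d h) :=
      (Measure.pi_map_pi fun h => (hm h).aemeasurable).symm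
    rw [h1]
    have : IsProbabilityMeasure
        ((Measure.pi fun h => (p h).toMeasure).map fun d h => emb h (d h)) :=
      Measure.isProbabilityMeasure_map (Measurable.of_discrete).aemeasurable
    exact (Measure.pi_map_pi fun k => (Measurable.of_discrete).aemeasurable).symm
  rw [expectedError, hlaw, lintegral_map _ (by fun_prop), lintegral_fintype]
  · refine Finset.sum_congr rfl fun D _ => ?_
    rw [Measure.pi_singleton]
    simp only [Measure.pi_singleton]
    simp only [PMF.toMeasure_apply_singleton _ _ (measurableSet_singleton _)]
    rw [mul_comm]
  · exact Measurable.lintegral_kernel (by fun_prop)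

end OPEProblem

namespace LatentModel

variable {Λ S A : Type}

/-- The offline policy evaluation problem given by a block MDP and a data collection policy that
depends on the latent state. -/
noncomputable def blockOPE (P : LatentModel Λ A) (lab : S → Λ) (emit : Λ → PMF S) (pol : Λ → PMF A)
    (a₀ : A) (H : ℕ) [NeZero H] (F : Set ((Fin H × S → A → ℝ) × (Fin H → ℝ)))
    (hF : ∀ f ∈ F, ∀ x a, f.1 x a ∈ Set.Icc (-1 : ℝ) 1) : OPEProblem (Fin H × S) A H where
  M := P.blockMDP lab emit H
  πe _ := a₀
  μ h := (P.blockMDP lab emit H).pairLaw (fun x => pol (lab x.2))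
    (MDP.act (fun x => pol (lab x.2)) (P.blockMDP lab emit H).init) h
  F := F
  μ_layer h p hp := by
    rw [PMF.mem_support_iff, MDP.pairLaw_act_init, MDP.act_apply] at hp
    exact Fin.ext (MDP.layer_of_stateLaw_ne_zero _ _ h.isLt (left_ne_zero_of_mul hp))
  F_mem := hF

/-- The law of the observed part of a tuple of layer `h`. -/
noncomputable def tupleLaw (P : LatentModel Λ A) (lab : S → Λ) (emit : Λ → PMF S) (pol : Λ → PMF A)
    (h : ℕ) : PMF (S × A × S) :=
  ((P.latentLaw emit (fun _ s => pol (lab s)) h).bind emit).bind fun s =>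
    (pol (lab s)).bind fun a => ((P.trans h (lab s) a).bind emit).map fun s' => (s, a, s')

variable (P : LatentModel Λ A) {lab : S → Λ} {emit : Λ → PMF S} (pol : Λ → PMF A)
    (a₀ : A) {H : ℕ} [NeZero H] (F : Set ((Fin H × S → A → ℝ) × (Fin H → ℝ)))
    (hF : ∀ f ∈ F, ∀ x a, f.1 x a ∈ Set.Icc (-1 : ℝ) 1)

theorem tupleLaw_apply (hemit : ∀ l s, emit l s ≠ 0 → lab s = l) (h : ℕ) (s : S) (a : A) (s' : S) :
    P.tupleLaw lab emit pol h (s, a, s') =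
      P.latentLaw emit (fun _ s => pol (lab s)) h (lab s) * pol (lab s) a *
        P.trans h (lab s) a (lab s') * (emit (lab s) s * emit (lab s') s') := by
  classical
  have h1 : ∀ (q : PMF S) (s₀ : S) (b : A),
      q.map (fun s' => (s₀, b, s')) (s, a, s') = if s₀ = s ∧ b = a then q s' else 0 := by
    intro q s₀ b
    rw [PMF.map_apply, tsum_eq_single s']
    · simp [eq_comm]
    · intro t ht
      rw [if_neg]
      simp [ht.symm]
  rw [tupleLaw, PMF.bind_apply, tsum_eq_single s, bind_emit_apply hemit, PMF.bind_apply,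
    tsum_eq_single a, h1, if_pos ⟨rfl, rfl⟩, bind_emit_apply hemit]
  · ring
  · intro b hb
    rw [h1, if_neg fun e => hb e.2, mul_zero]
  · intro t ht
    rw [PMF.bind_apply]
    refine mul_eq_zero_of_right _ (ENNReal.tsum_eq_zero.2 fun b => ?_)
    rw [h1, if_neg fun e => ht e.1, mul_zero]

theorem blockOPE_admissible : (P.blockOPE lab emit pol a₀ H F hF).Admissible :=
  ⟨fun x => pol (lab x.2), fun h x a => by
    simp only [blockOPE, MDP.occ_eq, MDP.pairLaw_act_init, MDP.act_apply]⟩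

/-- The concentrability coefficient of a block MDP is bounded by that of its latent MDP. -/
theorem concentrability_blockOPE_le (hemit : ∀ l s, emit l s ≠ 0 → lab s = l) (C : ℝ)
    (hC : ∀ (π : ℕ → S → PMF A) (h : ℕ), h < H → ∀ l a, (P.latentLaw emit π h l).toReal ≤
      C * ((P.latentLaw emit (fun _ s => pol (lab s)) h l).toReal * (pol l a).toReal))
    (hC0 : 0 ≤ C) (π : Policy (Fin H × S) A) :
    (P.blockOPE lab emit pol a₀ H F hF).M.concentrability
      (P.blockOPE lab emit pol a₀ H F hF).μ π ≤ ENNReal.ofReal C := by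
  refine iSup_le fun h => iSup_le fun x => iSup_le fun hx => iSup_le fun a => ?_
  obtain ⟨h', s⟩ := x
  obtain rfl : h' = h := hx
  refine ENNReal.div_le_of_le_mul ?_
  simp only [blockOPE]
  -- Both occupancies factor as latent mass times the same emission probability, so their ratio is a
  -- latent one.
  rw [MDP.occ_eq, MDP.pairLaw_act_init, MDP.act_apply, stateLaw_blockMDP_apply P hemit,
    stateLaw_blockMDP_apply P hemit]
  have key := hC (fun i s => π (Fin.ofNat H i, s)) h' h'.isLt (lab s) a
  have key' : P.latentLaw emit (fun i s => π (Fin.ofNat H i, s)) h' (lab s) ≤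
      ENNReal.ofReal C * (P.latentLaw emit (fun _ s => pol (lab s)) h' (lab s) * pol (lab s) a) := by
    rw [← ENNReal.toReal_le_toReal (PMF.apply_ne_top _ _) (by
      finiteness [PMF.apply_ne_top (P.latentLaw emit (fun _ s => pol (lab s)) h') (lab s),
        PMF.apply_ne_top (pol (lab s)) a]), ENNReal.toReal_mul, ENNReal.toReal_mul,
      ENNReal.toReal_ofReal hC0]
    exact key
  calc _ ≤ P.latentLaw emit (fun i s => π (Fin.ofNat H i, s)) h' (lab s) * emit (lab s) s * 1 := by
        gcongr
        exact PMF.coe_le_one _ _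
    _ ≤ ENNReal.ofReal C * (P.latentLaw emit (fun _ s => pol (lab s)) h' (lab s) * pol (lab s) a) *
        emit (lab s) s := by
        rw [mul_one]
        gcongr
    _ = _ := by ring

/-- Rewards are deterministic, so a tuple is a function of its observed part, which takes finitely
many values. This turns the expected error into a finite sum. -/
theorem transitionLaw_blockOPE [Fintype S] [Fintype A] [MeasurableSpace S] [DiscreteMeasurableSpace S] [MeasurableSpace A]
    [DiscreteMeasurableSpace A] (hemit : ∀ l s, emit l s ≠ 0 → lab s = l) (h : Fin H) :
    (P.blockOPE lab emit pol a₀ H F hF).transitionLaw h =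
      (P.tupleLaw lab emit pol h).toMeasure.map fun y =>
        ((h, y.1), y.2.1, P.reward h (lab y.1) y.2.1, (Fin.ofNat H (h + 1), y.2.2)) := by
  set q : PMF (S × A) := ((P.latentLaw emit (fun _ s => pol (lab s)) h).bind emit).bind fun s =>
    (pol (lab s)).map fun a => (s, a) with hq
  have hlaw : (P.blockOPE lab emit pol a₀ H F hF).μ h = q.map fun p => ((h, p.1), p.2) := by
    simp only [blockOPE, MDP.pairLaw_act_init]
    have hh : (Fin.ofNat H h : Fin H) = h := by simp
    rw [stateLaw_blockMDP P hemit _ h.isLt, hh, MDP.act, PMF.bind_map, hq, PMF.map_bind]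
    simp only [PMF.map_comp, Function.comp_def]
  have htuple : P.tupleLaw lab emit pol h = q.bind fun p =>
      ((P.trans h (lab p.1) p.2).bind emit).map fun s' => (p.1, p.2, s') := by
    simp only [tupleLaw, hq, PMF.bind_bind, PMF.bind_map, Function.comp_def]
  ext B hB
  rw [OPEProblem.transitionLaw, Measure.bind_apply hB Measurable.of_discrete.aemeasurable, hlaw,
    Measure.map_apply Measurable.of_discrete hB, ← PMF.toMeasure_map _ _ Measurable.of_discrete,
    lintegral_map Measurable.of_discrete Measurable.of_discrete, lintegral_fintype, htuple,
    PMF.toMeasure_bind_apply _ _ _ (Measurable.of_discrete hB), tsum_fintype]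
  have h1 : ∀ p : (Fin H × S) × A,
      Measure.map (fun s => (p.1, p.2, s.1, s.2))
        ((((P.blockOPE lab emit pol a₀ H F hF).M.reward p.1 p.2 : Measure (Set.Icc (-1 : ℝ) 1))).prod
          ((P.blockOPE lab emit pol a₀ H F hF).M.trans p.1 p.2).toMeasure) B =
      ((P.trans p.1.1 (lab p.1.2) p.2).bind emit).toMeasure {s' | ((p.1, p.2,
        P.reward p.1.1 (lab p.1.2) p.2, (Fin.ofNat H (p.1.1 + 1), s')) :
          Transition (Fin H × S) A) ∈ B} := by
    intro p
    simp only [blockOPE, blockMDP, ProbabilityMeasure.coe_mk]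
    rw [Measure.dirac_prod, Measure.map_map (by fun_prop) (by fun_prop),
      ← PMF.toMeasure_map _ _ Measurable.of_discrete, Measure.map_map (by fun_prop)
        Measurable.of_discrete, Measure.map_apply (by fun_prop) hB]
    rfl
  refine Finset.sum_congr rfl fun p _ => ?_
  rw [PMF.toMeasure_apply_singleton _ _ (measurableSet_singleton _), mul_comm, h1,
    PMF.toMeasure_map_apply _ _ _ Measurable.of_discrete (Measurable.of_discrete hB)]
  rfl

variable [Fintype Λ] [Fintype S] [Fintype A]

/-- The `W`-function of a block MDP, in terms of latent states. -/
theorem W_blockOPE (hemit : ∀ l s, emit l s ≠ 0 → lab s = l) (f : ℕ → Λ → A → ℝ)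
    (hQ : (P.blockMDP lab emit H).Q (MDP.detPolicy fun _ => a₀) = fun x a => f x.1 (lab x.2) a)
    (h : Fin H) :
    (P.blockOPE lab emit pol a₀ H F hF).M.W (P.blockOPE lab emit pol a₀ H F hF).μ
      (P.blockOPE lab emit pol a₀ H F hF).πe h =
      (P.latentLaw emit (fun _ s => pol (lab s)) h).expect fun l =>
        (pol l a₀).toReal * f h l a₀ := by
  classical
  rw [MDP.W, Finset.sum_filter, Fintype.sum_prod_type, Finset.sum_eq_single h]
  · simp only [blockOPE]
    rw [hQ, ← expect_bind_emit hemit, PMF.expect]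
    refine Finset.sum_congr rfl fun s _ => ?_
    have hs : (P.blockMDP lab emit H).layer (h, s) = h := rfl
    simp only [hs, if_true]
    rw [MDP.pairLaw_act_init, MDP.act_apply, stateLaw_blockMDP_apply P hemit,
      bind_emit_apply hemit, ENNReal.toReal_mul]
    ring
  · intro h' _ hh'
    exact Finset.sum_eq_zero fun s _ => if_neg hh'
  · simp

theorem value_blockMDP (hemit : ∀ l s, emit l s ≠ 0 → lab s = l) (f : ℕ → Λ → A → ℝ)
    (hQ : (P.blockMDP lab emit H).Q (MDP.detPolicy fun _ => a₀) = fun x a => f x.1 (lab x.2) a) :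
    (P.blockMDP lab emit H).value (MDP.detPolicy fun _ => a₀) =
      P.init.expect fun l => f 0 l a₀ := by
  rw [MDP.value_detPolicy, hQ, ← expect_bind_emit hemit]
  simp [blockMDP, PMF.expect_map, Function.comp_def]

end LatentModel

/-! ### Functions of disjoint sets of coordinates, and union bounds for product measures -/

section Product

theorem DependsOn.finset_prod {ι K : Type} {B : K → Type} {R : Type} [CommSemiring R] {F : ι → (∀ k, B k) → R} {s : ι → Set K}
    (h : ∀ t, DependsOn (F t) (s t)) (T : Finset ι) :
    DependsOn (fun x => ∏ t ∈ T, F t x) (⋃ t ∈ T, s t) := fun _ _ hxy =>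
  Finset.prod_congr rfl fun t ht => h t fun k hk => hxy k (Set.mem_biUnion ht hk)

variable {K : Type} {B : K → Type} [Fintype K] [DecidableEq K] [∀ k, Fintype (B k)]
  {R : Type} [CommSemiring R]

/-- Independence under the uniform measure, with denominators cleared. Exchanging the coordinates
outside `s` between two independent points is an involution that turns `f p.1 * g p.2` into a
function of one point. -/
theorem DependsOn.sum_mul_sum {f g : (∀ k, B k) → R} {s : Set K} (hf : DependsOn f s)
    (hg : DependsOn g sᶜ) :
    (∑ x, f x) * ∑ x, g x = Fintype.card (∀ k, B k) * ∑ x, f x * g x := by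
  classical
  let e : (∀ k, B k) × (∀ k, B k) → (∀ k, B k) × (∀ k, B k) :=
    fun p => (s.piecewise p.1 p.2, s.piecewise p.2 p.1)
  have he : Function.Involutive e := by
    rintro ⟨x, y⟩
    ext k <;> by_cases hk : k ∈ s <;> simp [e, hk]
  calc (∑ x, f x) * ∑ x, g x = ∑ p : (∀ k, B k) × (∀ k, B k), f p.1 * g p.2 := by
        rw [Fintype.sum_prod_type, Finset.sum_mul_sum]
    _ = ∑ p : (∀ k, B k) × (∀ k, B k), f (e p).1 * g (e p).1 := by
        refine Finset.sum_congr rfl fun p _ => ?_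
        rw [hf (x := p.1) (y := (e p).1) fun k hk => by simp [e, hk],
          hg (x := p.2) (y := (e p).1) fun k hk => by
            simp [e, Set.piecewise_eq_of_notMem _ _ _ (show k ∉ s from hk)]]
    _ = ∑ p : (∀ k, B k) × (∀ k, B k), f p.1 * g p.1 :=
        (Equiv.sum_comp he.toPerm fun p => f p.1 * g p.1)
    _ = _ := by
        rw [Fintype.sum_prod_type]
        simp [Finset.mul_sum, Finset.sum_const]

theorem DependsOn.sum_prod {ι : Type} {F : ι → (∀ k, B k) → R} {s : ι → Set K}
    (h : ∀ t, DependsOn (F t) (s t)) (hs : Pairwise fun t t' => Disjoint (s t) (s t'))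
    (T : Finset ι) :
    (Fintype.card (∀ k, B k) : R) ^ T.card * ∑ x, ∏ t ∈ T, F t x =
      Fintype.card (∀ k, B k) * ∏ t ∈ T, ∑ x, F t x := by
  classical
  induction T using Finset.induction_on with
  | empty => simp
  | insert i T hi ih =>
    have hdep : DependsOn (fun x => ∏ t ∈ T, F t x) (s i)ᶜ := by
      refine (DependsOn.finset_prod h T).mono ?_
      refine Set.iUnion₂_subset fun t ht => ?_
      exact (hs (show i ≠ t from fun e => hi (e ▸ ht))).subset_compl_left
    rw [Finset.card_insert_of_notMem hi, Finset.prod_insert hi]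
    simp only [Finset.prod_insert hi]
    calc _ = (Fintype.card (∀ k, B k) : R) ^ T.card *
          (Fintype.card (∀ k, B k) * ∑ x, F i x * ∏ t ∈ T, F t x) := by ring
      _ = (∑ x, F i x) *
          ((Fintype.card (∀ k, B k) : R) ^ T.card * ∑ x, ∏ t ∈ T, F t x) := by
          rw [← (h i).sum_mul_sum hdep]; ring
      _ = _ := by rw [ih]; ring

end Product

section UnionBound

variable {ι Y : Type} [Fintype ι] [DecidableEq ι] [Fintype Y] [MeasurableSpace Y]
  [DiscreteMeasurableSpace Y]

theorem measure_pi_le_of_forall_update (μ : ι → Measure Y) [∀ i, IsProbabilityMeasure (μ i)]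
    (i : ι) (S : Set (ι → Y)) (c : ℝ≥0∞)
    (h : ∀ D, μ i {y | Function.update D i y ∈ S} ≤ c) : Measure.pi μ S ≤ c := by
  have hne : Nonempty Y := (μ i).nonempty_of_neZero
  have hS : MeasurableSet S := MeasurableSet.of_discrete
  obtain ⟨D₀⟩ : Nonempty (ι → Y) := inferInstance
  have hm : Measurable (S.indicator (1 : (ι → Y) → ℝ≥0∞)) := Measurable.of_discrete
  have h1 : Measure.pi μ S = (∫⋯∫⁻_Finset.univ, S.indicator 1 ∂μ) D₀ := by
    rw [lmarginal_univ, lintegral_indicator_one hS]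
  rw [h1, lmarginal_erase' _ hm (Finset.mem_univ i)]
  -- Integrating out coordinate `i` first, with the others frozen, leaves the constant `c`.
  refine (lmarginal_mono (g := fun _ => c) (fun D => ?_) D₀).trans ?_
  · have : ∀ y, S.indicator (1 : (ι → Y) → ℝ≥0∞) (Function.update D i y) =
        {y | Function.update D i y ∈ S}.indicator 1 y := fun y => rfl
    simp only [this]
    rw [lintegral_indicator_one MeasurableSet.of_discrete]
    exact h D
  · simp [lmarginal]

/-- A union bound over single coordinates and ordered pairs. For a pair, the second coordinate is
frozen, which is why `hc` is required uniformly in `y'`. -/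
theorem one_le_sum_prod_add (p : ι → PMF Y) (bad : ι → Y → Prop) (clash : Y → Y → Prop)
    (good : (ι → Y) → Prop) [DecidablePred good]
    (hgood : ∀ D, (∀ t, ¬ bad t (D t)) → (∀ t t', t ≠ t' → ¬ clash (D t) (D t')) → good D)
    (b : ι → ℝ≥0∞) (c : ℝ≥0∞) (hb : ∀ t, (p t).toMeasure {y | bad t y} ≤ b t)
    (hc : ∀ t y', (p t).toMeasure {y | clash y y'} ≤ c) :
    1 ≤ (∑ D : ι → Y with good D, ∏ t, p t (D t)) + (∑ t, b t + Fintype.card ι ^ 2 * c) := by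
  set μ := Measure.pi fun t => (p t).toMeasure with hμ
  have hcover : (Set.univ : Set (ι → Y)) ⊆ {D | good D} ∪ ((⋃ t, {D | bad t (D t)}) ∪
      ⋃ q : ι × ι, {D | q.1 ≠ q.2 ∧ clash (D q.1) (D q.2)}) := by
    intro D _
    by_cases h1 : ∀ t, ¬ bad t (D t)
    · by_cases h2 : ∀ t t', t ≠ t' → ¬ clash (D t) (D t')
      · exact Or.inl (hgood D h1 h2)
      · push Not at h2
        obtain ⟨t, t', h⟩ := h2
        exact Or.inr (Or.inr (Set.mem_iUnion.2 ⟨(t, t'), h⟩))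
    · push Not at h1
      exact Or.inr (Or.inl (Set.mem_iUnion.2 h1))
  have hgoodm : μ {D | good D} = ∑ D : ι → Y with good D, ∏ t, p t (D t) := by
    have : {D | good D} = ((Finset.univ.filter good : Finset (ι → Y)) : Set (ι → Y)) := by
      ext D; simp
    rw [this, ← MeasureTheory.sum_measure_singleton]
    refine Finset.sum_congr rfl fun D _ => ?_
    rw [hμ, Measure.pi_singleton]
    exact Finset.prod_congr rfl fun t _ =>
      PMF.toMeasure_apply_singleton _ _ (measurableSet_singleton _)
  calc (1 : ℝ≥0∞) = μ Set.univ := measure_univ.symm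
    _ ≤ μ {D | good D} + (μ (⋃ t, {D | bad t (D t)}) +
        μ (⋃ q : ι × ι, {D | q.1 ≠ q.2 ∧ clash (D q.1) (D q.2)})) :=
        (measure_mono hcover).trans ((measure_union_le _ _).trans
          (add_le_add_right (measure_union_le _ _) _))
    _ ≤ _ := by
        rw [hgoodm]
        gcongr
        · refine (measure_iUnion_le _).trans ?_
          rw [tsum_fintype]
          refine Finset.sum_le_sum fun t _ => ?_
          refine measure_pi_le_of_forall_update _ t _ _ fun D => ?_
          simpa using hb t
        · refine (measure_iUnion_le _).trans ?_
          rw [tsum_fintype]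
          refine (Finset.sum_le_sum (g := fun _ => c) fun q _ => ?_).trans ?_
          · by_cases hq : q.1 = q.2
            · simp [hq]
            · refine measure_pi_le_of_forall_update _ q.1 _ _ fun D => ?_
              simpa [hq, Function.update_of_ne (Ne.symm hq)] using hc q.1 (D q.2)
          · simp [Finset.sum_const, sq]

end UnionBound

namespace HardOPE

/-! ### Latent states and their observations -/

/-- Latent states: the two hidden states `inl true` (good) and `inl false` (bad), and the visible
states `inr 0` (reward `1`), `inr 1` (reward `-1`) and `inr 2` (absorbing, reward `0`). -/
abbrev Lat := Bool ⊕ Fin 3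

/-- Observations: a hidden state is observed as a block number and a bit, and the bit reveals the
state only together with the hidden key of the block. -/
abbrev Obs (N : ℕ) : Type := (Fin (N + 1) × Bool) ⊕ Fin 3

instance (N : ℕ) : DiscreteMeasurableSpace (Obs N) :=
  ⟨fun _ => measurableSet_sum_iff.2 ⟨.of_discrete, .of_discrete⟩⟩

variable {N : ℕ}

/-- The latent state of an observation, given the keys of the blocks. -/
def lab (ψ : Fin (N + 1) → Bool) : Obs N → Lat
  | Sum.inl (k, b) => Sum.inl (xor b (ψ k))
  | Sum.inr z => Sum.inr z

/-- The law of the observation of a latent state: the block is uniform. -/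
noncomputable def emit (ψ : Fin (N + 1) → Bool) : Lat → PMF (Obs N)
  | Sum.inl l => (PMF.uniformOfFintype (Fin (N + 1))).map fun k => Sum.inl (k, xor l (ψ k))
  | Sum.inr z => PMF.pure (Sum.inr z)

/-- The blocks of an observation. -/
def blocks : Obs N → Set (Fin (N + 1))
  | Sum.inl (k, _) => {k}
  | Sum.inr _ => ∅

theorem lab_of_emit_ne_zero (ψ : Fin (N + 1) → Bool) (l : Lat) (s : Obs N) (h : emit ψ l s ≠ 0) :
    lab ψ s = l := by
  rw [← PMF.mem_support_iff] at h
  rcases l with l | z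
  · obtain ⟨k, -, rfl⟩ := (PMF.mem_support_map_iff _ _ _).1 h
    simp [lab]
  · rw [emit, PMF.mem_support_pure_iff] at h
    subst h
    rfl

/-- The key drops out: given its own latent state, an observation has a probability that depends
only on whether it is hidden or visible. -/
theorem emit_lab_apply (ψ : Fin (N + 1) → Bool) (s : Obs N) :
    emit ψ (lab ψ s) s = Sum.elim (fun _ => ((N + 1 : ℕ) : ℝ≥0∞)⁻¹) (fun _ => 1) s := by
  classical
  rcases s with ⟨k, b⟩ | z
  · simp only [lab, emit]
    rw [PMF.map_apply, tsum_eq_single k]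
    · simp
    · intro k' hk'
      rw [if_neg]
      intro e
      exact hk' (Prod.ext_iff.1 (Sum.inl.inj e)).1.symm
  · simp [lab, emit]

theorem lab_dependsOn (s : Obs N) : DependsOn (fun ψ => lab ψ s) (blocks s) := by
  intro ψ χ h
  rcases s with ⟨k, b⟩ | z
  · simp [lab, h k rfl]
  · rfl

open Classical in
/-- Each block is emitted with small probability. -/
theorem expect_emit_mem_blocks_le (ψ : Fin (N + 1) → Bool) (l : Lat) (k : Fin (N + 1)) :
    ((emit ψ l).expect fun s => if k ∈ blocks s then (1 : ℝ) else 0) ≤ 1 / (N + 1) := by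
  rcases l with l | z
  · rw [emit, PMF.expect_map, PMF.expect, Finset.sum_eq_single k]
    · have hN : ((N : ℝ≥0∞) + 1).toReal = N + 1 := by
        exact_mod_cast ENNReal.toReal_natCast (N + 1)
      simp [blocks, hN]
    · intro k' _ hk'
      simp [blocks, hk'.symm]
    · simp
  · rw [emit, PMF.expect_pure, blocks, if_neg (Set.notMem_empty _)]
    positivity

/-! ### The numerical parameters -/

/-- The mass of the bad state of layer `h` under the offline distribution, relative to the mass of
the good state. -/
noncomputable def badRatio (H h : ℕ) : ℝ := (1 + h / H) / (4 * H)

/-- The probability to go from a good state to a bad one under the evaluation policy. -/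
noncomputable def stay (H : ℕ) : ℝ := 1 - 1 / (2 * H)

/-- The probability of the evaluation action in a hidden state, for the data collection policy. -/
noncomputable def expl (H : ℕ) : ℝ := 1 / (8 * H ^ 2 - 4 * H + 1)

/-- The absolute value of a hidden state. -/
noncomputable def val (H : ℕ) : ℕ → ℝ
  | 0 => 1 / 4
  | h + 1 => val H h * (1 + badRatio H h) / stay H

/-- The initial mass of the good state. -/
noncomputable def initGood (H : ℕ) (ε : ℝ) : ℝ := 8 * ε / (1 + badRatio H 0)

/-- The mass of the good state of layer `h` under the offline distribution. -/
noncomputable def goodMass (H : ℕ) (ε : ℝ) (h : ℕ) : ℝ := initGood H ε * ((1 - expl H) / 2) ^ h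

/-- The sign of the hidden values. -/
def sgn (σ : Bool) : ℝ := if σ then 1 else -1

theorem sgn_cases (σ : Bool) : sgn σ = 1 ∨ sgn σ = -1 := by cases σ <;> simp [sgn]

section Numbers

variable {H : ℕ} (hH : 1 ≤ H)

include hH

theorem badRatio_ge (h : ℕ) : 1 / (4 * H) ≤ badRatio H h := by
  have : (0 : ℝ) < H := by exact_mod_cast hH
  rw [badRatio]
  gcongr
  have : (0 : ℝ) ≤ h / H := by positivity
  linarith

theorem badRatio_pos (h : ℕ) : 0 < badRatio H h := by
  have : (0 : ℝ) < H := by exact_mod_cast hH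
  rw [badRatio]
  positivity

theorem badRatio_le {h : ℕ} (h' : h ≤ H) : badRatio H h ≤ 1 / (2 * H) := by
  have hH0 : (0 : ℝ) < H := by exact_mod_cast hH
  have : (h : ℝ) / H ≤ 1 := by
    rw [div_le_one hH0]; exact_mod_cast h'
  rw [badRatio, div_le_div_iff₀ (by positivity) (by positivity)]
  nlinarith

theorem inv_two_mul_le : 1 / (2 * (H : ℝ)) ≤ 1 / 2 := by
  have : (1 : ℝ) ≤ H := by exact_mod_cast hH
  gcongr
  linarith

theorem badRatio_succ (h : ℕ) : badRatio H (h + 1) = badRatio H h + 1 / (4 * H ^ 2) := by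
  have hH0 : (H : ℝ) ≠ 0 := by positivity
  rw [badRatio, badRatio]
  push_cast
  field_simp
  ring

theorem badRatio_zero_le : badRatio H 0 ≤ 1 / 4 := by
  have : (1 : ℝ) ≤ H := by exact_mod_cast hH
  rw [badRatio, div_le_iff₀ (by positivity)]
  simp
  linarith

theorem stay_pos : 0 < stay H := by
  have := inv_two_mul_le hH
  rw [stay]
  linarith

theorem expl_den_ge : 4 * (H : ℝ) ^ 2 + 1 ≤ 8 * (H : ℝ) ^ 2 - 4 * H + 1 := by
  have : (1 : ℝ) ≤ H := by exact_mod_cast hH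
  nlinarith

theorem expl_pos : 0 < expl H := by
  have := expl_den_ge hH
  rw [expl]
  have : 0 < 8 * (H : ℝ) ^ 2 - 4 * H + 1 := by nlinarith
  positivity

theorem expl_ge : 1 / (8 * (H : ℝ) ^ 2) ≤ expl H := by
  have h1 : (1 : ℝ) ≤ H := by exact_mod_cast hH
  have := expl_den_ge hH
  rw [expl]
  refine one_div_le_one_div_of_le (by nlinarith) (by linarith)

theorem expl_mul_le : H * expl H ≤ 1 / 2 := by
  have h1 : (1 : ℝ) ≤ H := by exact_mod_cast hH
  have := expl_den_ge hH
  rw [expl, mul_one_div, div_le_iff₀ (by nlinarith)]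
  nlinarith

theorem expl_le : expl H ≤ 1 / 2 := by
  have h1 : (1 : ℝ) ≤ H := by exact_mod_cast hH
  have := expl_mul_le hH
  have := expl_pos hH
  nlinarith

/-- This equation determines `expl H`. The flow from good to bad, relative to the surviving good
mass, must equal the increment of `badRatio` in `badRatio_succ`. -/
theorem expl_mul_stay : expl H * stay H = (1 - expl H) / 2 * (1 / (4 * H ^ 2)) := by
  have h1 : (1 : ℝ) ≤ H := by exact_mod_cast hH
  have h2 : 8 * (H : ℝ) ^ 2 - 4 * H + 1 ≠ 0 := by nlinarith
  have h3 : (1 - 1 / (8 * (H : ℝ) ^ 2 - 4 * H + 1)) =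
      (8 * H ^ 2 - 4 * H) / (8 * (H : ℝ) ^ 2 - 4 * H + 1) := by
    rw [eq_div_iff h2, sub_mul, one_div_mul_cancel h2]
    ring
  rw [expl, stay, h3]
  field_simp
  ring

theorem val_pos (h : ℕ) : 0 < val H h := by
  induction h with
  | zero => norm_num [val]
  | succ h ih =>
    have := badRatio_pos hH h
    have := stay_pos hH
    rw [val]
    positivity

theorem stay_mul_val_succ (h : ℕ) : stay H * val H (h + 1) = val H h * (1 + badRatio H h) := by
  rw [val, mul_div_cancel₀ _ (stay_pos hH).ne']

/-- The growth factor per layer is at most `(2 * H + 1) / (2 * H - 1)`, hence at most `exp (2 / (2 *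
H - 1))`. Over at most `H - 2` layers the total growth is at most `e`, and the initial value `1 / 4`
leaves room since `e / 4 < 1`. -/
theorem val_le_one {h : ℕ} (h' : h ≤ H - 2) : val H h ≤ 1 := by
  have h1 : (1 : ℝ) ≤ H := by exact_mod_cast hH
  have key : ∀ i ≤ H, val H i ≤ 1 / 4 * Real.exp (i * (2 / (2 * H - 1))) := by
    intro i
    induction i with
    | zero => simp [val]
    | succ i ih =>
      intro hi
      have hst := stay_pos hH
      have h2 := badRatio_le hH (h := i) (by omega)
      have h3 : (1 + badRatio H i) / stay H ≤ Real.exp (2 / (2 * H - 1)) := by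
        refine le_trans ?_ (Real.add_one_le_exp _)
        rw [div_le_iff₀ hst]
        calc 1 + badRatio H i ≤ 1 + 1 / (2 * H) := by linarith
          _ = _ := by
            have : (2 * (H : ℝ) - 1) ≠ 0 := by linarith
            rw [stay]
            field_simp
            ring
      rw [val, mul_div_assoc]
      have h4 := ih (by omega)
      have h5 := badRatio_pos hH i
      calc _ ≤ (1 / 4 * Real.exp (i * (2 / (2 * H - 1)))) * Real.exp (2 / (2 * H - 1)) := by
            gcongr
        _ = _ := by
          rw [mul_assoc, ← Real.exp_add]
          congr 2
          push_cast
          ring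
  refine (key h (by omega)).trans ?_
  have h2 : (h : ℝ) * (2 / (2 * H - 1)) ≤ 1 := by
    rw [mul_div_assoc', div_le_one (by linarith)]
    rcases Nat.eq_zero_or_pos h with rfl | hpos
    · simp; linarith
    · have : (h : ℝ) + 2 ≤ H := by exact_mod_cast (by omega : h + 2 ≤ H)
      linarith
  have h3 : Real.exp (h * (2 / (2 * H - 1))) ≤ Real.exp 1 := Real.exp_le_exp.2 h2
  have := Real.exp_one_lt_d9
  linarith

/-- The leak out of the good state must be large enough to carry the compensating bias; this makes
the weights in `stepWeights` nonnegative. -/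
theorem badRatio_mul_val_le {h : ℕ} (h' : h ≤ H - 2) : badRatio H h * val H h ≤ 1 - stay H := by
  have h1 := badRatio_le hH (h := h) (by omega)
  have h2 := val_le_one hH h'
  have h3 := val_pos hH h
  have h4 := badRatio_pos hH h
  rw [stay]
  nlinarith

theorem initGood_mul (ε : ℝ) : initGood H ε * (1 + badRatio H 0) = 8 * ε := by
  have := badRatio_pos hH 0
  rw [initGood, div_mul_cancel₀ _ (by positivity)]

theorem initGood_pos {ε : ℝ} (hε : 0 < ε) : 0 < initGood H ε := by
  have := badRatio_pos hH 0
  rw [initGood]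
  positivity

theorem initGood_le {ε : ℝ} (hε : 0 < ε) : initGood H ε ≤ 8 * ε := by
  have := badRatio_pos hH 0
  rw [← initGood_mul hH ε]
  nlinarith [initGood_pos hH hε]

theorem goodMass_nonneg {ε : ℝ} (hε : 0 < ε) (h : ℕ) : 0 ≤ goodMass H ε h := by
  have := initGood_pos hH hε
  have := expl_le hH
  have : 0 ≤ (1 - expl H) / 2 := by linarith
  rw [goodMass]
  positivity

theorem goodMass_ge {ε : ℝ} (hε : 0 < ε) {h : ℕ} (h' : h ≤ H) :
    initGood H ε * (1 / 2) ^ h / 2 ≤ goodMass H ε h := by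
  have h0 := initGood_pos hH hε
  have h1 := expl_le hH
  have h2 := expl_mul_le hH
  have h3 := expl_pos hH
  have h4 : (h : ℝ) ≤ H := by exact_mod_cast h'
  -- Bernoulli: since `H * expl H ≤ 1 / 2`, exploration costs at most half of the mass over all
  -- layers.
  have h5 : 1 + (h : ℝ) * (-expl H) ≤ (1 + -expl H) ^ h :=
    one_add_mul_le_pow (by linarith) h
  have h6 : (1 : ℝ) / 2 ≤ (1 - expl H) ^ h := by
    rw [sub_eq_add_neg]
    nlinarith
  rw [goodMass, div_eq_mul_one_div (1 - expl H), mul_pow, ← mul_assoc]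
  calc initGood H ε * (1 / 2) ^ h / 2 = initGood H ε * (1 / 2) * (1 / 2) ^ h := by ring
    _ ≤ _ := by gcongr

theorem goodMass_le {ε : ℝ} (hε : 0 < ε) (h : ℕ) :
    goodMass H ε h ≤ initGood H ε * (1 / 2) ^ h := by
  have h0 := initGood_pos hH hε
  have h1 := expl_le hH
  have h3 := expl_pos hH
  rw [goodMass]
  gcongr
  · linarith
  · linarith

end Numbers

/-! ### The latent models -/

/-- The weight function on latent states with the given values. -/
def wt (u v x y z : ℝ) : Lat → ℝ := Sum.elim (fun b => if b then u else v) ![x, y, z]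

theorem sum_lat (f : Lat → ℝ) : ∑ l, f l =
    f (Sum.inl true) + f (Sum.inl false) + f (Sum.inr 0) + f (Sum.inr 1) + f (Sum.inr 2) := by
  simp [Fintype.sum_sum_type, Fin.sum_univ_three, add_assoc]

theorem forall_lat {p : Lat → Prop} (h1 : p (Sum.inl true)) (h2 : p (Sum.inl false))
    (h3 : p (Sum.inr 0)) (h4 : p (Sum.inr 1)) (h5 : p (Sum.inr 2)) (l : Lat) : p l := by
  rcases l with l | z
  · cases l <;> assumption
  · fin_cases z <;> assumption

@[simp] theorem wt_good (u v x y z : ℝ) : wt u v x y z (Sum.inl true) = u := rfl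
@[simp] theorem wt_bad (u v x y z : ℝ) : wt u v x y z (Sum.inl false) = v := rfl
@[simp] theorem wt_zero (u v x y z : ℝ) : wt u v x y z (Sum.inr 0) = x := rfl
@[simp] theorem wt_one (u v x y z : ℝ) : wt u v x y z (Sum.inr 1) = y := rfl
@[simp] theorem wt_two (u v x y z : ℝ) : wt u v x y z (Sum.inr 2) = z := rfl

/-- Transition probabilities before the last rewarded layer. -/
noncomputable def stepWeights (H : ℕ) (σ : Bool) (h : ℕ) : Lat → Fin 2 → Lat → ℝ
  | Sum.inl true, 0 => wt 0 (stay H) ((1 - stay H - sgn σ * (badRatio H h * val H h)) / 2)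
      ((1 - stay H + sgn σ * (badRatio H h * val H h)) / 2) 0
  | Sum.inl false, 0 => wt 0 0 ((1 + sgn σ * val H h) / 2) ((1 - sgn σ * val H h) / 2) 0
  | Sum.inl true, 1 => wt (1 / 2) 0 0 0 (1 / 2)
  | Sum.inl false, 1 => wt 0 (1 / 2) 0 0 (1 / 2)
  | Sum.inr _, _ => wt 0 0 0 0 1

/-- Transition probabilities. -/
noncomputable def transWeights (H : ℕ) (σ : Bool) (h : ℕ) (l : Lat) (a : Fin 2) : Lat → ℝ :=
  if h < H - 2 then stepWeights H σ h l a else wt 0 0 0 0 1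

/-- Rewards. -/
noncomputable def rew (H : ℕ) (σ : Bool) (h : ℕ) (l : Lat) (a : Fin 2) : ℝ :=
  if h ≤ H - 2 then
    Sum.elim (fun _ => if h = H - 2 ∧ a = 0 then sgn σ * val H h else 0) ![1, -1, 0] l
  else 0

/-- State-action values of the evaluation policy. -/
noncomputable def qVal (H : ℕ) (σ : Bool) (h : ℕ) (l : Lat) (a : Fin 2) : ℝ :=
  if h ≤ H - 2 then
    Sum.elim (fun _ => if a = 0 then sgn σ * val H h else
      if h < H - 2 then sgn σ * val H (h + 1) / 2 else 0) ![1, -1, 0] l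
  else 0

/-- Initial probabilities. -/
noncomputable def initWeights (H : ℕ) (ε : ℝ) : Lat → ℝ :=
  wt (initGood H ε) (badRatio H 0 * initGood H ε) 0 0 (1 - 8 * ε)

/-- The latent model with sign `σ`. -/
noncomputable def model (H : ℕ) (ε : ℝ) (σ : Bool) : LatentModel Lat (Fin 2) where
  init := PMF.ofWeights (Sum.inr 2) (initWeights H ε)
  trans h l a := PMF.ofWeights (Sum.inr 2) (transWeights H σ h l a)
  reward h l a := Set.projIcc (-1) 1 (by norm_num) (rew H σ h l a)

/-- Action probabilities of the data collection policy. -/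
noncomputable def polWeights (H : ℕ) : Lat → Fin 2 → ℝ
  | Sum.inl _ => ![expl H, 1 - expl H]
  | Sum.inr _ => ![1 / 2, 1 / 2]

/-- The data collection policy. -/
noncomputable def pol (H : ℕ) (l : Lat) : PMF (Fin 2) := PMF.ofWeights 0 (polWeights H l)

section

variable {H : ℕ} (hH : 1 ≤ H) {ε : ℝ} (hε : 0 < ε) (hε' : ε ≤ 1 / 15) (σ : Bool)

include hH

theorem polWeights_nonneg (l : Lat) (a : Fin 2) : 0 ≤ polWeights H l a := by
  have := expl_pos hH
  have := expl_le hH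
  rcases l with l | l <;> fin_cases a <;> simp [polWeights] <;> linarith

omit hH in
theorem polWeights_sum (l : Lat) : ∑ a, polWeights H l a = 1 := by
  rcases l with l | l <;> norm_num [polWeights]

theorem toReal_pol (l : Lat) (a : Fin 2) : (pol H l a).toReal = polWeights H l a :=
  PMF.toReal_ofWeights _ (polWeights_nonneg hH l) (polWeights_sum l) a

theorem transWeights_nonneg (h : ℕ) (l : Lat) (a : Fin 2) (l' : Lat) :
    0 ≤ transWeights H σ h l a l' := by
  rw [transWeights]
  split_ifs with hh
  · have h1 := badRatio_mul_val_le hH hh.le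
    have h2 := val_le_one hH hh.le
    have h3 := val_pos hH h
    have h4 := mul_pos (badRatio_pos hH h) h3
    have h5 := stay_pos hH
    revert l l'
    refine forall_lat ?_ ?_ ?_ ?_ ?_ <;> refine forall_lat ?_ ?_ ?_ ?_ ?_ <;> fin_cases a <;>
      rcases sgn_cases σ with hs | hs <;> simp [stepWeights, hs] <;> linarith
  · revert l'
    refine forall_lat ?_ ?_ ?_ ?_ ?_ <;> simp

omit hH in
theorem transWeights_sum (h : ℕ) (l : Lat) (a : Fin 2) : ∑ l', transWeights H σ h l a l' = 1 := by
  rw [sum_lat, transWeights]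
  split_ifs with hh
  · revert l
    refine forall_lat ?_ ?_ ?_ ?_ ?_ <;> fin_cases a <;> simp [stepWeights] <;> ring
  · simp

theorem toReal_trans (h : ℕ) (l : Lat) (a : Fin 2) (l' : Lat) :
    ((model H ε σ).trans h l a l').toReal = transWeights H σ h l a l' :=
  PMF.toReal_ofWeights _ (transWeights_nonneg hH σ h l a) (transWeights_sum σ h l a) l'

theorem expect_trans (h : ℕ) (l : Lat) (a : Fin 2) (v : Lat → ℝ) :
    ((model H ε σ).trans h l a).expect v = ∑ l', transWeights H σ h l a l' * v l' :=
  PMF.expect_ofWeights _ (transWeights_nonneg hH σ h l a) (transWeights_sum σ h l a) v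

include hε hε' in
theorem initWeights_nonneg (l : Lat) : 0 ≤ initWeights H ε l := by
  have h1 := initGood_pos hH hε
  have h2 := mul_pos (badRatio_pos hH 0) h1
  revert l
  refine forall_lat ?_ ?_ ?_ ?_ ?_ <;> simp [initWeights] <;> linarith

theorem initWeights_sum : ∑ l, initWeights H ε l = 1 := by
  have := initGood_mul hH ε
  simp only [sum_lat, initWeights, wt_good, wt_bad, wt_zero, wt_one, wt_two]
  linarith

include hε hε' in
theorem toReal_init (l : Lat) : ((model H ε σ).init l).toReal = initWeights H ε l :=
  PMF.toReal_ofWeights _ (initWeights_nonneg hH hε hε') (initWeights_sum hH) l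

include hε hε' in
theorem expect_init (v : Lat → ℝ) :
    (model H ε σ).init.expect v = ∑ l, initWeights H ε l * v l :=
  PMF.expect_ofWeights _ (initWeights_nonneg hH hε hε') (initWeights_sum hH) v

theorem rew_mem (h : ℕ) (l : Lat) (a : Fin 2) : rew H σ h l a ∈ Set.Icc (-1 : ℝ) 1 := by
  rw [rew]
  by_cases hh : h ≤ H - 2
  · rw [if_pos hh]
    have h2 := val_le_one hH hh
    have h3 := val_pos hH h
    revert l
    refine forall_lat ?_ ?_ ?_ ?_ ?_ <;> rcases sgn_cases σ with hs | hs <;>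
      simp only [hs, Sum.elim_inl, Sum.elim_inr] <;> (try split_ifs) <;> constructor <;>
      simp <;> linarith
  · simp [hh]

theorem coe_reward (h : ℕ) (l : Lat) (a : Fin 2) :
    ((model H ε σ).reward h l a : ℝ) = rew H σ h l a := by
  simp only [model]
  rw [Set.projIcc_of_mem _ (rew_mem hH σ h l a)]

theorem qVal_mem (h : ℕ) (l : Lat) (a : Fin 2) : qVal H σ h l a ∈ Set.Icc (-1 : ℝ) 1 := by
  rw [qVal]
  by_cases hh : h ≤ H - 2
  · rw [if_pos hh]
    have h2 := val_le_one hH hh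
    have h3 := val_pos hH h
    have h4 : h < H - 2 → val H (h + 1) ≤ 1 := fun h' => val_le_one hH h'
    have h5 := val_pos hH (h + 1)
    have hidden : (if a = 0 then sgn σ * val H h else
        if h < H - 2 then sgn σ * val H (h + 1) / 2 else 0) ∈ Set.Icc (-1 : ℝ) 1 := by
      split_ifs with h6 h7
      · rcases sgn_cases σ with hs | hs <;> rw [hs] <;> constructor <;> linarith
      · have := h4 h7
        rcases sgn_cases σ with hs | hs <;> rw [hs] <;> constructor <;> linarith
      · simp
    revert l
    refine forall_lat hidden hidden ?_ ?_ ?_ <;> simp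
  · simp [hh]

omit hH in
theorem qVal_last (h : ℕ) (hh : h + 1 = H) (l : Lat) (a : Fin 2) :
    qVal H σ h l a = rew H σ h l a := by
  rw [qVal, rew]
  by_cases h1 : h ≤ H - 2
  · have h2 : h = H - 2 := by omega
    rw [if_pos h1, if_pos h1]
    congr 1
    funext _
    simp [← h2]
  · rw [if_neg h1, if_neg h1]

/-- In the good state, the gain `stay H * val H (h + 1)` through the bad state exceeds `val H h` by
exactly the opposite bias `badRatio H h * val H h` of the visible exits. The recursion for `val` is
chosen for this. -/
theorem qVal_step (h : ℕ) (hh : h + 1 < H) (l : Lat) (a : Fin 2) :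
    qVal H σ h l a = rew H σ h l a +
      ((model H ε σ).trans h l a).expect fun l' => qVal H σ (h + 1) l' 0 := by
  rw [expect_trans hH, sum_lat]
  have h1 : h ≤ H - 2 := by omega
  by_cases h2 : h < H - 2
  · have h3 : h + 1 ≤ H - 2 := h2
    have h4 : h ≠ H - 2 := h2.ne
    have h5 := stay_mul_val_succ hH h
    revert l
    refine forall_lat ?_ ?_ ?_ ?_ ?_ <;> fin_cases a <;>
      simp [qVal, rew, transWeights, stepWeights, h1, h2, h3, h4]
    · linear_combination (-sgn σ) * h5
    all_goals ring
  · have h3 : ¬ h + 1 ≤ H - 2 := h2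
    have h4 : h = H - 2 := le_antisymm h1 (not_lt.1 h2)
    revert l
    refine forall_lat ?_ ?_ ?_ ?_ ?_ <;> fin_cases a <;>
      simp [qVal, rew, transWeights, ← h4]

end

/-! ### Occupancies -/

/-- The mass of each of the visible states with rewards `1` and `-1` in layer `h`. -/
noncomputable def zMass (H : ℕ) (ε : ℝ) : ℕ → ℝ
  | 0 => 0
  | h + 1 => expl H * goodMass H ε h * (1 - stay H + badRatio H h) / 2

/-- The latent occupancy measure of the data collection policy. -/
noncomputable def offline (H : ℕ) (ε : ℝ) (h : ℕ) : Lat → ℝ :=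
  if h ≤ H - 2 then
    wt (goodMass H ε h) (badRatio H h * goodMass H ε h) (zMass H ε h) (zMass H ε h)
      (1 - (1 + badRatio H h) * goodMass H ε h - 2 * zMass H ε h)
  else wt 0 0 0 0 1

theorem expect_wt (p : PMF Lat) (u v x y z : ℝ) : p.expect (wt u v x y z) =
    (p (Sum.inl true)).toReal * u + (p (Sum.inl false)).toReal * v + (p (Sum.inr 0)).toReal * x +
      (p (Sum.inr 1)).toReal * y + (p (Sum.inr 2)).toReal * z := by
  simp only [PMF.expect, sum_lat, wt_good, wt_bad, wt_zero, wt_one, wt_two]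

theorem toReal_inr_two (p : PMF Lat) : (p (Sum.inr 2)).toReal = 1 - (p (Sum.inl true)).toReal -
    (p (Sum.inl false)).toReal - (p (Sum.inr 0)).toReal - (p (Sum.inr 1)).toReal := by
  have := p.sum_toReal
  rw [sum_lat] at this
  linarith

section

variable {N H : ℕ} (hH : 1 ≤ H) {ε : ℝ} (hε : 0 < ε) (hε' : ε ≤ 1 / 15) (σ : Bool)
  (ψ : Fin (N + 1) → Bool)

/-- The latent occupancy measure of layer `h` for the data collection policy. -/
noncomputable abbrev offlineLaw (H : ℕ) (ε : ℝ) (σ : Bool) (ψ : Fin (N + 1) → Bool) (h : ℕ) :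
    PMF Lat :=
  (model H ε σ).latentLaw (emit ψ) (fun _ s => pol H (lab ψ s)) h

include hH

theorem toReal_offlineLaw_succ (h : ℕ) (l' : Lat) :
    (offlineLaw H ε σ ψ (h + 1) l').toReal = ∑ l, (offlineLaw H ε σ ψ h l).toReal *
      ∑ a, polWeights H l a * transWeights H σ h l a l' := by
  rw [offlineLaw, LatentModel.latentLaw_succ_of_label _ (lab_of_emit_ne_zero ψ),
    PMF.toReal_bind_apply]
  simp only [PMF.toReal_bind_apply, toReal_pol hH, toReal_trans hH]

include hε hε'

theorem toReal_offlineLaw (h : ℕ) (l : Lat) :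
    (offlineLaw H ε σ ψ h l).toReal = offline H ε h l := by
  induction h generalizing l with
  | zero =>
    have h1 : (offlineLaw H ε σ ψ 0 l).toReal = initWeights H ε l := toReal_init hH hε hε' σ l
    have h2 := initGood_mul hH ε
    rw [h1]
    clear h1
    revert l
    refine forall_lat ?_ ?_ ?_ ?_ ?_ <;> simp [initWeights, offline, goodMass, zMass]
    linarith
  | succ h ih =>
    have hsucc : ∀ l', (offlineLaw H ε σ ψ (h + 1) l').toReal = ∑ l, offline H ε h l *
        ∑ a, polWeights H l a * transWeights H σ h l a l' := fun l' => by
      rw [toReal_offlineLaw_succ hH]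
      simp only [ih]
    by_cases h1 : h < H - 2
    · have h2 : h + 1 ≤ H - 2 := h1
      have hgood : (offlineLaw H ε σ ψ (h + 1) (Sum.inl true)).toReal = goodMass H ε (h + 1) := by
        rw [hsucc]
        simp [transWeights, h1, stepWeights, polWeights, offline, h1.le, goodMass, pow_succ]
        ring
      have hbad : (offlineLaw H ε σ ψ (h + 1) (Sum.inl false)).toReal =
          badRatio H (h + 1) * goodMass H ε (h + 1) := by
        rw [hsucc, badRatio_succ hH]
        have h3 := expl_mul_stay hH
        simp [transWeights, h1, stepWeights, polWeights, offline, h1.le, goodMass, pow_succ]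
        simp only [one_div, mul_inv] at h3
        linear_combination (initGood H ε * ((1 - expl H) / 2) ^ h) * h3
      have hz0 : (offlineLaw H ε σ ψ (h + 1) (Sum.inr 0)).toReal = zMass H ε (h + 1) := by
        rw [hsucc]
        simp [transWeights, h1, stepWeights, polWeights, offline, h1.le, zMass]
        ring
      have hz1 : (offlineLaw H ε σ ψ (h + 1) (Sum.inr 1)).toReal = zMass H ε (h + 1) := by
        rw [hsucc]
        simp [transWeights, h1, stepWeights, polWeights, offline, h1.le, zMass]
        ring
      -- The absorbing mass is what remains of total mass one.
      have hj := toReal_inr_two (offlineLaw H ε σ ψ (h + 1))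
      rw [hgood, hbad, hz0, hz1] at hj
      rw [offline, if_pos h2]
      revert l
      refine forall_lat hgood hbad hz0 hz1 (hj.trans ?_)
      rw [wt_two]
      ring
    · have h2 : ¬ h + 1 ≤ H - 2 := h1
      have h3 : ∀ l', wt 0 0 0 0 1 l' = 0 →
          (offlineLaw H ε σ ψ (h + 1) l').toReal = 0 := fun l' hl' => by
        rw [hsucc]
        simp [transWeights, h1, hl']
      rw [offline, if_neg h2]
      revert l
      refine forall_lat (h3 _ rfl) (h3 _ rfl) (h3 _ rfl) (h3 _ rfl) ?_
      rw [toReal_inr_two, h3 _ rfl, h3 _ rfl, h3 _ rfl, h3 _ rfl]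
      simp

theorem offline_inr_two_ge (h : ℕ) : 1 - 8 * ε ≤ offline H ε h (Sum.inr 2) := by
  -- The formula `offline` involves neither sign nor keys, so any instance will do. The absorbing
  -- state is never left, so its initial mass persists.
  have key : 1 - 8 * ε ≤ (offlineLaw H ε true (fun _ : Fin 1 => true) h (Sum.inr 2)).toReal := by
    induction h with
    | zero => exact (toReal_init hH hε hε' true (Sum.inr 2)).ge
    | succ h ih =>
      rw [toReal_offlineLaw_succ hH]
      refine ih.trans ?_
      have h1 : ∑ a, polWeights H (Sum.inr 2) a *
          transWeights H true h (Sum.inr 2) a (Sum.inr 2) = 1 := by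
        simp only [transWeights, stepWeights, ite_self, wt_two, mul_one, polWeights_sum]
      refine le_trans ?_ (Finset.single_le_sum (f := fun l =>
        (offlineLaw H ε true (fun _ : Fin 1 => true) h l).toReal * ∑ a, polWeights H l a *
          transWeights H true h l a (Sum.inr 2)) (fun l _ => ?_) (Finset.mem_univ (Sum.inr 2)))
      · simp only [h1, mul_one, le_refl]
      · exact mul_nonneg ENNReal.toReal_nonneg (Finset.sum_nonneg fun a _ =>
          mul_nonneg (polWeights_nonneg hH _ _) (transWeights_nonneg hH _ _ _ _ _))
  rwa [toReal_offlineLaw hH hε hε'] at key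

/-! ### Concentrability -/

variable (π : ℕ → Obs N → PMF (Fin 2))

/-- A good state counts double because the evaluation action can make it bad with probability close
to one; going from weight 2 to weight 1 still halves the potential. The other action halves it by
absorption. Initially `2 + badRatio H 0 ≤ 9 / 4`. -/
theorem expect_potential_le {h : ℕ} (hh : h ≤ H - 2) :
    ((model H ε σ).latentLaw (emit ψ) π h).expect (wt 2 1 0 0 0) ≤
      9 / 4 * (initGood H ε * (1 / 2) ^ h) := by
  induction h with
  | zero =>
    have h1 := badRatio_zero_le hH
    have h2 := initGood_pos hH hε
    rw [LatentModel.latentLaw, expect_init hH hε hε', sum_lat]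
    simp [initWeights]
    nlinarith
  | succ h ih =>
    have h1 : h < H - 2 := hh
    refine (LatentModel.expect_latentLaw_succ_le _ _ _ (v := fun l => 1 / 2 * wt 2 1 0 0 0 l)
      fun l a => ?_).trans ?_
    · have hst : stay H ≤ 1 := by
        rw [stay, sub_le_self_iff]; positivity
      rw [expect_trans hH, sum_lat]
      revert l
      refine forall_lat ?_ ?_ ?_ ?_ ?_ <;> fin_cases a <;>
        simp [transWeights, h1, stepWeights, hst]
    · have := ih h1.le
      calc _ = 1 / 2 * ((model H ε σ).latentLaw (emit ψ) π h).expect (wt 2 1 0 0 0) := by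
            simp only [PMF.expect, Finset.mul_sum]
            exact Finset.sum_congr rfl fun _ _ => by ring
        _ ≤ 1 / 2 * (9 / 4 * (initGood H ε * (1 / 2) ^ h)) := by gcongr
        _ = _ := by rw [pow_succ]; ring

theorem toReal_latentLaw_good_le {h : ℕ} (hh : h ≤ H - 2) :
    ((model H ε σ).latentLaw (emit ψ) π h (Sum.inl true)).toReal ≤
      initGood H ε * (1 / 2) ^ h := by
  induction h with
  | zero =>
    rw [LatentModel.latentLaw, toReal_init hH hε hε']
    simp [initWeights]
  | succ h ih =>
    have h1 : h < H - 2 := hh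
    have h2 := LatentModel.expect_latentLaw_succ_le (model H ε σ) (emit ψ) π (j := h)
      (v := wt (1 / 2) 0 0 0 0) (w := wt 1 0 0 0 0) fun l a => by
        rw [expect_trans hH, sum_lat]
        revert l
        refine forall_lat ?_ ?_ ?_ ?_ ?_ <;> fin_cases a <;>
          simp [transWeights, h1, stepWeights]
    rw [expect_wt, expect_wt] at h2
    have := ih h1.le
    rw [pow_succ]
    linarith

theorem toReal_latentLaw_bad_le {h : ℕ} (hh : h ≤ H - 2) :
    ((model H ε σ).latentLaw (emit ψ) π h (Sum.inl false)).toReal ≤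
      9 / 4 * (initGood H ε * (1 / 2) ^ h) := by
  have h1 := expect_potential_le hH hε hε' σ ψ π hh
  rw [expect_wt] at h1
  have : 0 ≤ ((model H ε σ).latentLaw (emit ψ) π h (Sum.inl true)).toReal :=
    ENNReal.toReal_nonneg
  linarith

/-- Visible mass comes from the previous layer: all of a bad state, but at most `1 / (2 * H) ≤ 1 /
2` of a good one. This gives `1 / 2 + 9 / 4 = 11 / 4`. -/
theorem toReal_latentLaw_visible_le {h : ℕ} (hh : h < H - 2) :
    ((model H ε σ).latentLaw (emit ψ) π (h + 1) (Sum.inr 0)).toReal +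
      ((model H ε σ).latentLaw (emit ψ) π (h + 1) (Sum.inr 1)).toReal ≤
      11 / 4 * (initGood H ε * (1 / 2) ^ h) := by
  have h0 := inv_two_mul_le hH
  have h2 := LatentModel.expect_latentLaw_succ_le (model H ε σ) (emit ψ) π (j := h)
    (v := wt (1 / 2) 1 0 0 0) (w := wt 0 0 1 1 0) fun l a => by
      rw [expect_trans hH, sum_lat]
      revert l
      refine forall_lat ?_ ?_ ?_ ?_ ?_ <;> fin_cases a <;>
        simp [transWeights, hh, stepWeights]
      · rw [stay]; linarith
      · linarith
  rw [expect_wt, expect_wt] at h2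
  have h3 := toReal_latentLaw_good_le hH hε hε' σ ψ π hh.le
  have h4 := toReal_latentLaw_bad_le hH hε hε' σ ψ π hh.le
  have h5 : (0 : ℝ) ≤ initGood H ε * (1 / 2) ^ h := by
    have := initGood_pos hH hε
    positivity
  linarith

omit hε hε' in
theorem toReal_latentLaw_eq_zero {h : ℕ} (hh : ¬ h < H - 2) (l : Lat) (hl : l ≠ Sum.inr 2) :
    ((model H ε σ).latentLaw (emit ψ) π (h + 1) l).toReal = 0 := by
  have h2 := LatentModel.expect_latentLaw_succ_le (model H ε σ) (emit ψ) π (j := h)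
    (v := wt 0 0 0 0 0) (w := wt 1 1 1 1 0) fun l a => by
      rw [expect_trans hH, sum_lat]
      revert l
      refine forall_lat ?_ ?_ ?_ ?_ ?_ <;> simp [transWeights, hh]
  rw [expect_wt, expect_wt] at h2
  have h3 : ∀ l, 0 ≤ ((model H ε σ).latentLaw (emit ψ) π (h + 1) l).toReal :=
    fun l => ENNReal.toReal_nonneg
  have e1 := h3 (Sum.inl true)
  have e2 := h3 (Sum.inl false)
  have e3 := h3 (Sum.inr 0)
  have e4 := h3 (Sum.inr 1)
  revert l
  refine forall_lat ?_ ?_ ?_ ?_ ?_ <;> intro hl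
  on_goal 5 => exact absurd rfl hl
  all_goals linarith

omit hε hε' in
theorem polWeights_hidden_ge (l : Bool) (a : Fin 2) :
    1 / (8 * (H : ℝ) ^ 2) ≤ polWeights H (Sum.inl l) a := by
  have h1 := expl_ge hH
  have h2 := expl_le hH
  fin_cases a <;> simp only [polWeights] <;> simp <;> simp at h1 <;> linarith

theorem latent_concentrability (h : ℕ) (l : Lat) (a : Fin 2) :
    ((model H ε σ).latentLaw (emit ψ) π h l).toReal ≤
      384 * (H : ℝ) ^ 3 * ((offlineLaw H ε σ ψ h l).toReal * (pol H l a).toReal) := by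
  have hH1 : (1 : ℝ) ≤ H := by exact_mod_cast hH
  have hG := initGood_pos hH hε
  rw [toReal_offlineLaw hH hε hε', toReal_pol hH]
  have hnn : ∀ l, 0 ≤ 384 * (H : ℝ) ^ 3 * (offline H ε h l * polWeights H l a) := fun l => by
    have := polWeights_nonneg hH l a
    have : 0 ≤ offline H ε h l := by
      rw [← toReal_offlineLaw hH hε hε' σ ψ]; exact ENNReal.toReal_nonneg
    positivity
  have hhalf : ∀ z, polWeights H (Sum.inr z) a = 1 / 2 := fun z => by
    fin_cases a <;> rfl
  have habs : ((model H ε σ).latentLaw (emit ψ) π h (Sum.inr 2)).toReal ≤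
      384 * (H : ℝ) ^ 3 * (offline H ε h (Sum.inr 2) * polWeights H (Sum.inr 2) a) := by
    have h1 := offline_inr_two_ge hH hε hε' h
    rw [hhalf]
    have h2 : ((model H ε σ).latentLaw (emit ψ) π h (Sum.inr 2)).toReal ≤ 1 :=
      ENNReal.toReal_le_of_le_ofReal zero_le_one (by simpa using PMF.coe_le_one _ _)
    have h3 : (1 : ℝ) ≤ (H : ℝ) ^ 3 := one_le_pow₀ hH1
    nlinarith
  by_cases hh : h ≤ H - 2
  · set m := initGood H ε * (1 / 2) ^ h with hm
    have hm0 : 0 < m := by positivity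
    have h1 := goodMass_ge hH hε (h := h) (by omega)
    have h2 := badRatio_ge hH h
    have hgm := goodMass_nonneg hH hε h
    have hbr := (badRatio_pos hH h).le
    have hz : ((model H ε σ).latentLaw (emit ψ) π h (Sum.inr 0)).toReal +
        ((model H ε σ).latentLaw (emit ψ) π h (Sum.inr 1)).toReal ≤
        384 * (H : ℝ) ^ 3 * (zMass H ε h * (1 / 2)) := by
      rcases h with _ | i
      · rw [LatentModel.latentLaw, toReal_init hH hε hε', toReal_init hH hε hε']
        simp [initWeights, zMass]
      · have h3 := toReal_latentLaw_visible_le hH hε hε' σ ψ π (h := i) hh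
        have h4 := goodMass_ge hH hε (h := i) (by omega)
        have h5 := badRatio_ge hH i
        have h6 := expl_ge hH
        have h8 := goodMass_nonneg hH hε i
        have h9 := (expl_pos hH).le
        have h7 : 1 - stay H = 2 * (1 / (4 * (H : ℝ))) := by
          rw [stay]; field_simp; ring
        refine h3.trans ?_
        set r := initGood H ε * (1 / 2) ^ i
        have hr : 0 < r := by positivity
        -- The visible states are the tightest case: the offline mass is at least `3 * r / (256 * H
        -- ^ 3)`, and `384 * 3 / 256 = 9 / 2` exceeds `11 / 4`.
        calc 11 / 4 * r ≤ 384 * (H : ℝ) ^ 3 * (1 / (8 * (H : ℝ) ^ 2) * (r / 2) *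
              (2 * (1 / (4 * (H : ℝ))) + 1 / (4 * (H : ℝ))) / 2 * (1 / 2)) := by
              field_simp
              norm_num
          _ ≤ _ := by
              rw [zMass, h7]
              gcongr
    have hz0 : (0 : ℝ) ≤ ((model H ε σ).latentLaw (emit ψ) π h (Sum.inr 0)).toReal :=
      ENNReal.toReal_nonneg
    have hz1 : (0 : ℝ) ≤ ((model H ε σ).latentLaw (emit ψ) π h (Sum.inr 1)).toReal :=
      ENNReal.toReal_nonneg
    revert l
    refine forall_lat ?_ ?_ ?_ ?_ habs
    · refine (toReal_latentLaw_good_le hH hε hε' σ ψ π hh).trans ?_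
      rw [← hm, offline, if_pos hh, wt_good]
      have h3 := polWeights_hidden_ge hH true a
      calc m ≤ 384 * (H : ℝ) ^ 3 * (m / 2 * (1 / (8 * (H : ℝ) ^ 2))) := by
            field_simp
            linarith
        _ ≤ _ := by gcongr
    · refine (toReal_latentLaw_bad_le hH hε hε' σ ψ π hh).trans ?_
      rw [← hm, offline, if_pos hh, wt_bad]
      have h3 := polWeights_hidden_ge hH false a
      calc 9 / 4 * m ≤ 384 * (H : ℝ) ^ 3 * (1 / (4 * (H : ℝ)) * (m / 2) *
            (1 / (8 * (H : ℝ) ^ 2))) := by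
            field_simp
            norm_num
        _ ≤ _ := by gcongr
    · rw [offline, if_pos hh, wt_zero, hhalf]
      linarith
    · rw [offline, if_pos hh, wt_one, hhalf]
      linarith
  · obtain ⟨i, rfl⟩ : ∃ i, h = i + 1 := ⟨h - 1, by omega⟩
    by_cases hl : l = Sum.inr 2
    · rw [hl]; exact habs
    · rw [toReal_latentLaw_eq_zero hH σ ψ π (by omega) l hl]
      exact hnn l

end

/-! ### The law of the offline tuples -/

section

variable {N H : ℕ} (hH : 1 ≤ H) {ε : ℝ} (hε : 0 < ε) (hε' : ε ≤ 1 / 15) (σ : Bool)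
  (ψ : Fin (N + 1) → Bool)

/-- The law of the observed part of a tuple of layer `h`. -/
noncomputable abbrev tup (H : ℕ) (ε : ℝ) (σ : Bool) (ψ : Fin (N + 1) → Bool) (h : ℕ) :
    PMF (Obs N × Fin 2 × Obs N) :=
  (model H ε σ).tupleLaw (lab ψ) (emit ψ) (pol H) h

/-- The weight of the latent part of a tuple. -/
noncomputable def latentWeight (H : ℕ) (ε : ℝ) (σ : Bool) (h : ℕ) (l : Lat) (a : Fin 2)
    (l' : Lat) : ℝ :=
  offline H ε h l * polWeights H l a * transWeights H σ h l a l'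

include hH hε hε'

theorem offline_nonneg (h : ℕ) (l : Lat) : 0 ≤ offline H ε h l := by
  rw [← toReal_offlineLaw hH hε hε' true (fun _ : Fin 1 => true)]
  exact ENNReal.toReal_nonneg

theorem latentWeight_nonneg (h : ℕ) (l : Lat) (a : Fin 2) (l' : Lat) :
    0 ≤ latentWeight H ε σ h l a l' :=
  mul_nonneg (mul_nonneg (offline_nonneg hH hε hε' h l) (polWeights_nonneg hH l a))
    (transWeights_nonneg hH σ h l a l')

theorem tup_apply (h : ℕ) (y : Obs N × Fin 2 × Obs N) :
    tup H ε σ ψ h y = ENNReal.ofReal (latentWeight H ε σ h (lab ψ y.1) y.2.1 (lab ψ y.2.2)) *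
      (Sum.elim (fun _ => ((N + 1 : ℕ) : ℝ≥0∞)⁻¹) (fun _ => 1) y.1 *
        Sum.elim (fun _ => ((N + 1 : ℕ) : ℝ≥0∞)⁻¹) (fun _ => 1) y.2.2) := by
  obtain ⟨s, a, s'⟩ := y
  have h1 : ∀ {α : Type} (p : PMF α) (x : α), p x = ENNReal.ofReal (p x).toReal :=
    fun p x => (ENNReal.ofReal_toReal (p.apply_ne_top x)).symm
  rw [tup, LatentModel.tupleLaw_apply _ _ (lab_of_emit_ne_zero ψ), emit_lab_apply,
    emit_lab_apply, h1 (pol H _), h1 ((model H ε σ).trans _ _ _),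
    h1 ((model H ε σ).latentLaw _ _ _), toReal_offlineLaw hH hε hε', toReal_pol hH,
    toReal_trans hH, latentWeight,
    ENNReal.ofReal_mul (mul_nonneg (offline_nonneg hH hε hε' _ _) (polWeights_nonneg hH _ _)),
    ENNReal.ofReal_mul (offline_nonneg hH hε hε' _ _)]

theorem tup_dependsOn (h : ℕ) (y : Obs N × Fin 2 × Obs N) :
    DependsOn (fun ψ => tup H ε σ ψ h y) (blocks y.1 ∪ blocks y.2.2) := by
  intro ψ χ hψ
  simp only [tup_apply hH hε hε']
  rw [show lab ψ y.1 = lab χ y.1 from lab_dependsOn y.1 fun k hk => hψ k (Or.inl hk),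
    show lab ψ y.2.2 = lab χ y.2.2 from lab_dependsOn y.2.2 fun k hk => hψ k (Or.inr hk)]

omit hH hε hε' in
/-- Averaged over the two hidden states, the offline transitions do not depend on the sign. -/
theorem latentWeight_add (h : ℕ) (a : Fin 2) (l' : Lat) :
    latentWeight H ε true h (Sum.inl true) a l' + latentWeight H ε true h (Sum.inl false) a l' =
      latentWeight H ε false h (Sum.inl true) a l' +
        latentWeight H ε false h (Sum.inl false) a l' := by
  by_cases hh : h < H - 2
  -- The sign enters only through the evaluation action into a visible state, where the good bias is
  -- weighted by `goodMass` and the opposite bad bias by `badRatio * goodMass`.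
  · revert l'
    refine forall_lat ?_ ?_ ?_ ?_ ?_ <;> fin_cases a <;>
      simp [latentWeight, transWeights, hh, stepWeights, offline, hh.le, polWeights, sgn] <;> ring
  · simp [latentWeight, transWeights, hh]

/-- Averaged over the keys, the law of the tuples does not depend on the sign. -/
theorem sum_tup_eq (h : ℕ) (y : Obs N × Fin 2 × Obs N) (hy : Disjoint (blocks y.1) (blocks y.2.2)) :
    ∑ ψ, tup H ε true ψ h y = ∑ ψ, tup H ε false ψ h y := by
  simp only [tup_apply hH hε hε']
  rw [← Finset.sum_mul, ← Finset.sum_mul]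
  congr 1
  obtain ⟨s, a, s'⟩ := y
  rcases s with ⟨k, b⟩ | z
  · have hk : k ∉ blocks s' := Set.disjoint_singleton_left.1 hy
    -- Flipping the key of the first observation's block swaps good and bad there, while the label
    -- of the next observation is unchanged by disjointness. Pairing `ψ` with `e ψ` reduces the
    -- claim to `latentWeight_add`.
    let e : (Fin (N + 1) → Bool) → Fin (N + 1) → Bool := fun ψ => Function.update ψ k (!ψ k)
    have he : Function.Involutive e := fun ψ => by simp [e]
    have hsum : ∀ G : (Fin (N + 1) → Bool) → ℝ≥0∞, 2 * ∑ ψ, G ψ = ∑ ψ, (G ψ + G (e ψ)) :=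
      fun G => by
        rw [Finset.sum_add_distrib, two_mul]
        congr 1
        exact (Equiv.sum_comp he.toPerm G).symm
    rw [← ENNReal.mul_right_inj (a := 2) (by simp) (by simp), hsum, hsum]
    refine Finset.sum_congr rfl fun ψ _ => ?_
    have h1 : lab (e ψ) s' = lab ψ s' := lab_dependsOn s' fun i hi => by
      have : i ≠ k := fun h => hk (h ▸ hi)
      simp [e, this]
    have h2 : lab (e ψ) (Sum.inl (k, b) : Obs N) = Sum.inl (!(xor b (ψ k))) := by
      simp [lab, e]
    simp only [h1, h2]
    rw [← ENNReal.ofReal_add (latentWeight_nonneg hH hε hε' _ _ _ _ _)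
        (latentWeight_nonneg hH hε hε' _ _ _ _ _),
      ← ENNReal.ofReal_add (latentWeight_nonneg hH hε hε' _ _ _ _ _)
        (latentWeight_nonneg hH hε hε' _ _ _ _ _)]
    congr 1
    have h3 := latentWeight_add (H := H) (ε := ε) h a (lab ψ s')
    simp only [lab]
    cases xor b (ψ k)
    · rw [add_comm, add_comm (latentWeight H ε false _ _ _ _)]
      exact h3
    · exact h3
  · refine Finset.sum_congr rfl fun ψ _ => ?_
    simp [latentWeight, transWeights, stepWeights, lab]

/-! ### Unlikely events -/

omit hH hε hε'

open Classical in
/-- The indicator of the event that two observations have a common block. -/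
noncomputable def meet (s s' : Obs N) : ℝ := if Disjoint (blocks s) (blocks s') then 0 else 1

theorem expect_emit_meet_le (l : Lat) (s : Obs N) :
    ((emit ψ l).expect fun s' => meet s' s) ≤ 1 / (N + 1) := by
  classical
  rcases s with ⟨k, b⟩ | z
  · refine le_trans (le_of_eq ?_) (expect_emit_mem_blocks_le ψ l k)
    refine PMF.expect_congr _ fun s' _ => ?_
    have : Disjoint (blocks s') (blocks (Sum.inl (k, b) : Obs N)) ↔ k ∉ blocks s' :=
      Set.disjoint_singleton_right
    rw [meet, this]
    split_ifs <;> tauto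
  · have : ∀ s', meet s' (Sum.inr z : Obs N) = 0 := fun s' =>
      if_pos (Set.disjoint_empty _)
    simp only [this, PMF.expect_const]
    positivity

theorem expect_bind_emit_meet_le (p : PMF Lat) (s : Obs N) :
    ((p.bind (emit ψ)).expect fun s' => meet s' s) ≤ 1 / (N + 1) := by
  rw [PMF.expect_bind]
  exact PMF.expect_le _ fun l _ => expect_emit_meet_le ψ l s

theorem expect_tup (h : ℕ) (v : Obs N × Fin 2 × Obs N → ℝ) :
    (tup H ε σ ψ h).expect v = ((offlineLaw H ε σ ψ h).bind (emit ψ)).expect fun s =>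
      (pol H (lab ψ s)).expect fun a =>
        (((model H ε σ).trans h (lab ψ s) a).bind (emit ψ)).expect fun s' => v (s, a, s') := by
  rw [tup, LatentModel.tupleLaw, PMF.expect_bind]
  congr 1
  funext s
  rw [PMF.expect_bind]
  congr 1
  funext a
  rw [PMF.expect_map]
  rfl

theorem expect_tup_meet_fst_le (h : ℕ) (s : Obs N) :
    ((tup H ε σ ψ h).expect fun y => meet y.1 s) ≤ 1 / (N + 1) := by
  simp only [expect_tup, PMF.expect_const]
  exact expect_bind_emit_meet_le ψ _ s

theorem expect_tup_meet_snd_le (h : ℕ) (s : Obs N) :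
    ((tup H ε σ ψ h).expect fun y => meet y.2.2 s) ≤ 1 / (N + 1) := by
  rw [expect_tup]
  exact PMF.expect_le _ fun _ _ => PMF.expect_le _ fun _ _ => expect_bind_emit_meet_le ψ _ s

theorem expect_tup_meet_le (h : ℕ) :
    ((tup H ε σ ψ h).expect fun y => meet y.2.2 y.1) ≤ 1 / (N + 1) := by
  rw [expect_tup]
  exact PMF.expect_le _ fun s _ => PMF.expect_le _ fun _ _ => expect_bind_emit_meet_le ψ _ s

/-- Two tuples have a common block. -/
def Clash (y y' : Obs N × Fin 2 × Obs N) : Prop :=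
  ¬ Disjoint (blocks y.1 ∪ blocks y.2.2) (blocks y'.1 ∪ blocks y'.2.2)

theorem toMeasure_clash_le (h : ℕ) (y' : Obs N × Fin 2 × Obs N) :
    (tup H ε σ ψ h).toMeasure {y | Clash y y'} ≤ ENNReal.ofReal (4 / (N + 1)) := by
  classical
  rw [PMF.toMeasure_setOf]
  refine ENNReal.ofReal_le_ofReal ?_
  have h1 : ∀ y : Obs N × Fin 2 × Obs N, (if Clash y y' then (1 : ℝ) else 0) ≤
      (meet y.1 y'.1 + meet y.1 y'.2.2) + (meet y.2.2 y'.1 + meet y.2.2 y'.2.2) := by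
    intro y
    by_cases p1 : Disjoint (blocks y.1) (blocks y'.1) <;>
      by_cases p2 : Disjoint (blocks y.1) (blocks y'.2.2) <;>
      by_cases p3 : Disjoint (blocks y.2.2) (blocks y'.1) <;>
      by_cases p4 : Disjoint (blocks y.2.2) (blocks y'.2.2) <;>
      norm_num [Clash, Set.disjoint_union_left, Set.disjoint_union_right, meet, p1, p2, p3, p4]
  refine (PMF.expect_mono _ fun y _ => h1 y).trans ?_
  rw [PMF.expect_add, PMF.expect_add, PMF.expect_add]
  have e1 := expect_tup_meet_fst_le (H := H) (ε := ε) σ ψ h y'.1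
  have e2 := expect_tup_meet_fst_le (H := H) (ε := ε) σ ψ h y'.2.2
  have e3 := expect_tup_meet_snd_le (H := H) (ε := ε) σ ψ h y'.1
  have e4 := expect_tup_meet_snd_le (H := H) (ε := ε) σ ψ h y'.2.2
  have : (4 : ℝ) / (N + 1) = 4 * (1 / (N + 1)) := by ring
  linarith

/-- The tuple of layer `h` may reveal the sign or use a block twice. -/
def Revealing (H : ℕ) (h : ℕ) (y : Obs N × Fin 2 × Obs N) : Prop :=
  (h = H - 2 ∧ y.1.isLeft = true) ∨ ¬ Disjoint (blocks y.2.2) (blocks y.1)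

-- The constant is `8 * ε` for the initial good mass times `1 + badRatio ≤ 3 / 2`.
include hH hε hε' in
theorem toMeasure_revealing_le (h : ℕ) :
    (tup H ε σ ψ h).toMeasure {y | Revealing H h y} ≤
      ENNReal.ofReal ((if h = H - 2 then 12 * ε * (1 / 2) ^ (H - 2) else 0) + 1 / (N + 1)) := by
  classical
  rw [PMF.toMeasure_setOf]
  refine ENNReal.ofReal_le_ofReal ?_
  have h1 : ∀ y : Obs N × Fin 2 × Obs N, (if Revealing H h y then (1 : ℝ) else 0) ≤
      (if h = H - 2 then wt 1 1 0 0 0 (lab ψ y.1) else 0) + meet y.2.2 y.1 := by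
    rintro ⟨s, a, s'⟩
    have hwt : wt 1 1 0 0 0 (lab ψ s) = if s.isLeft = true then 1 else 0 := by
      rcases s with ⟨k, b⟩ | z
      · simp only [lab]
        cases xor b (ψ k) <;> rfl
      · simp only [lab]
        fin_cases z <;> rfl
    simp only [Revealing, hwt, meet]
    by_cases p1 : h = H - 2 <;> by_cases p2 : s.isLeft = true <;>
      by_cases p3 : Disjoint (blocks s') (blocks s) <;> simp [p1, p2, p3]
  refine (PMF.expect_mono _ fun y _ => h1 y).trans ?_
  rw [PMF.expect_add]
  refine add_le_add ?_ (expect_tup_meet_le σ ψ h)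
  rw [expect_tup]
  simp only [PMF.expect_const]
  by_cases hh : h = H - 2
  · simp only [if_pos hh]
    rw [LatentModel.expect_bind_emit (lab_of_emit_ne_zero ψ), expect_wt,
      toReal_offlineLaw hH hε hε', toReal_offlineLaw hH hε hε', offline, if_pos hh.le, wt_good,
      wt_bad, hh]
    have h2 := goodMass_le hH hε (H - 2)
    have h3 := badRatio_le hH (h := H - 2) (by omega)
    have h4 := inv_two_mul_le hH
    have h5 := initGood_le hH hε
    have h6 := goodMass_nonneg hH hε (H - 2)
    have h7 : (0 : ℝ) < (1 / 2) ^ (H - 2) := by positivity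
    have h8 : initGood H ε * (1 / 2) ^ (H - 2) ≤ 8 * ε * (1 / 2) ^ (H - 2) := by gcongr
    nlinarith
  · simp only [if_neg hh, PMF.expect_const, le_refl]

end

/-! ### The class of offline policy evaluation problems -/

section

variable {N H : ℕ} [NeZero H] (hH : 1 ≤ H) {ε : ℝ} (hε : 0 < ε) (hε' : ε ≤ 1 / 15) (σ : Bool)
  (ψ : Fin (N + 1) → Bool)

/-- The state-action value function of the evaluation policy. -/
noncomputable def qFun (N H : ℕ) (σ : Bool) (x : Fin H × Obs N) (a : Fin 2) : ℝ :=
  qVal H σ x.1 (lab (fun _ => true) x.2) a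

/-- The `W`-function of the evaluation policy. -/
noncomputable def wFun (H : ℕ) (ε : ℝ) (σ : Bool) (h : Fin H) : ℝ :=
  ∑ l, offline H ε h l * (polWeights H l 0 * qVal H σ h l 0)

/-- The function class. -/
noncomputable def funClass (N H : ℕ) (ε : ℝ) :
    Set ((Fin H × Obs N → Fin 2 → ℝ) × (Fin H → ℝ)) :=
  Set.range fun σ => (qFun N H σ, wFun H ε σ)

omit [NeZero H] in
theorem qVal_lab (h : ℕ) (s : Obs N) (a : Fin 2) :
    qVal H σ h (lab ψ s) a = qVal H σ h (lab (fun _ => true) s) a := by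
  rcases s with s | z <;> rfl

omit [NeZero H] in
theorem reward_lab (h : ℕ) (s : Obs N) (a : Fin 2) :
    (model H ε σ).reward h (lab ψ s) a = (model H ε σ).reward h (lab (fun _ => true) s) a := by
  rcases s with s | z <;> rfl

omit [NeZero H] in
include hH in
theorem funClass_mem_Icc : ∀ f ∈ funClass N H ε, ∀ x a, f.1 x a ∈ Set.Icc (-1 : ℝ) 1 := by
  rintro _ ⟨σ, rfl⟩ x a
  exact qVal_mem hH σ _ _ a

/-- The problem with sign `σ` and keys `ψ`. -/
noncomputable def prob (hH : 1 ≤ H) (ε : ℝ) (σ : Bool) (ψ : Fin (N + 1) → Bool) :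
    OPEProblem (Fin H × Obs N) (Fin 2) H :=
  (model H ε σ).blockOPE (lab ψ) (emit ψ) (pol H) 0 H (funClass N H ε) (funClass_mem_Icc hH)

include hH

omit [NeZero H] in
theorem qFun_ne : qFun N H true ≠ qFun N H false := fun h => by
  have h1 := congrFun (congrFun h (⟨0, hH⟩, Sum.inl (0, true))) 0
  have h2 := val_pos hH 0
  simp [qFun, qVal, lab, sgn] at h1
  linarith

omit [NeZero H] in
theorem ncard_funClass : (funClass N H ε).ncard = 2 := by
  have : funClass N H ε = {(qFun N H true, wFun H ε true), (qFun N H false, wFun H ε false)} := by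
    ext f
    simp [funClass, or_comm]
  rw [this, Set.ncard_pair fun h => qFun_ne hH (Prod.ext_iff.1 h).1]

omit [NeZero H] in
theorem ncard_fst_funClass : (Prod.fst '' funClass N H ε).ncard = 2 := by
  have : Prod.fst '' funClass N H ε = {qFun N H true, qFun N H false} := by
    ext f
    simp [funClass, or_comm, eq_comm]
  rw [this, Set.ncard_pair (qFun_ne hH)]

theorem Q_model : ((model H ε σ).blockMDP (lab ψ) (emit ψ) H).Q (MDP.detPolicy fun _ => 0) =
    fun x a => qVal H σ x.1 (lab ψ x.2) a :=
  LatentModel.Q_blockMDP _ (lab_of_emit_ne_zero ψ) 0 (qVal H σ)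
    (fun j l a hj => (qVal_last σ j hj l a).trans (coe_reward hH σ j l a).symm)
    fun j l a hj => by rw [coe_reward hH]; exact qVal_step hH σ j hj l a

include hε hε'

/-- Neither component sees the keys: the hidden states share their values (`qVal_lab`), and the
latent offline law and action probabilities are key-free. -/
theorem realizable_prob : (prob hH ε σ ψ).Realizable := by
  refine ⟨σ, Prod.ext ?_ ?_⟩
  · refine Eq.trans ?_ (Q_model (ε := ε) hH σ ψ).symm
    funext x a
    exact (qVal_lab σ ψ _ _ a).symm
  · funext h
    refine Eq.trans ?_ (LatentModel.W_blockOPE (model H ε σ) (pol H) 0 (funClass N H ε)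
      (funClass_mem_Icc hH) (lab_of_emit_ne_zero ψ) (qVal H σ) (Q_model hH σ ψ) h).symm
    simp only [PMF.expect, wFun, toReal_offlineLaw hH hε hε', toReal_pol hH]

theorem value_prob : (prob hH ε σ ψ).M.value (MDP.detPolicy (prob hH ε σ ψ).πe) =
    sgn σ * (2 * ε) := by
  refine (LatentModel.value_blockMDP (model H ε σ) 0 (lab_of_emit_ne_zero ψ) (qVal H σ)
    (Q_model hH σ ψ)).trans ?_
  rw [expect_init hH hε hε', sum_lat]
  have := initGood_mul hH ε
  simp [initWeights, qVal, val]
  linear_combination (sgn σ / 4) * this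

theorem concentrability_prob (π : Policy (Fin H × Obs N) (Fin 2)) :
    (prob hH ε σ ψ).M.concentrability (prob hH ε σ ψ).μ π ≤ ENNReal.ofReal (384 * (H : ℝ) ^ 3) :=
  LatentModel.concentrability_blockOPE_le _ _ _ _ _ (lab_of_emit_ne_zero ψ) _
    (fun π h _ l a => latent_concentrability hH hε hε' σ ψ π h l a) (by positivity) π

omit hε hε' in
theorem meanReward_prob_last (h2 : 2 ≤ H) (x : Fin H × Obs N) (a : Fin 2)
    (hx : ((prob hH ε σ ψ).M.layer x : ℕ) + 1 = H) : (prob hH ε σ ψ).M.meanReward x a = 0 := by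
  refine (LatentModel.meanReward_blockMDP _ _ _ _ _ _).trans ?_
  have hx' : (x.1 : ℕ) + 1 = H := hx
  rw [coe_reward hH, rew, if_neg (by omega)]

/-! ### The lower bound -/

/-- The tuple of layer `h` with the given observed part. -/
noncomputable def embTuple (H N : ℕ) [NeZero H] (ε : ℝ) (σ : Bool) (h : Fin (H - 1))
    (y : Obs N × Fin 2 × Obs N) : Transition (Fin H × Obs N) (Fin 2) :=
  ((h.castLE (Nat.sub_le H 1), y.1), y.2.1,
    (model H ε σ).reward h (lab (fun _ => true) y.1) y.2.1, (Fin.ofNat H (h + 1), y.2.2))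

/-- The error of an estimator on the data set with the given observed part. -/
noncomputable def errAt {n : ℕ} (est : Kernel (Dataset (Fin H × Obs N) (Fin 2) H n) ℝ) (ε : ℝ)
    (σ : Bool) (D : Fin n × Fin (H - 1) → Obs N × Fin 2 × Obs N) : ℝ≥0∞ :=
  ∫⁻ v, ENNReal.ofReal |v - sgn σ * (2 * ε)| ∂(est fun k h => embTuple H N ε σ h (D (k, h)))

theorem expectedError_prob {n : ℕ} (est : Kernel (Dataset (Fin H × Obs N) (Fin 2) H n) ℝ) :
    (prob hH ε σ ψ).expectedError est =
      ∑ D : Fin n × Fin (H - 1) → Obs N × Fin 2 × Obs N,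
        (∏ t, tup H ε σ ψ t.2 (D t)) * errAt est ε σ D := by
  rw [OPEProblem.expectedError_eq_sum (prob hH ε σ ψ) (fun h => tup H ε σ ψ h)
    (embTuple H N ε σ) (fun h => ?_) est, value_prob hH hε hε']
  · refine (Fintype.sum_equiv (Equiv.curry _ _ _) _ _ fun D => ?_).symm
    rw [Fintype.prod_prod_type]
    rfl
  · rw [prob, LatentModel.transitionLaw_blockOPE _ _ _ _ _ (lab_of_emit_ne_zero ψ)]
    -- Good and bad states have equal rewards, so a dummy key suffices and the embedding of the data
    -- does not depend on `ψ`.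
    simp only [reward_lab]
    rfl

omit [NeZero H] hH hε hε' in
theorem reward_eq_of_not_revealing (h : ℕ) (y : Obs N × Fin 2 × Obs N) (hy : ¬ Revealing H h y) :
    (model H ε true).reward h (lab (fun _ => true) y.1) y.2.1 =
      (model H ε false).reward h (lab (fun _ => true) y.1) y.2.1 := by
  obtain ⟨s, a, s'⟩ := y
  rw [Revealing, not_or] at hy
  rcases s with s | z
  · have h1 : h ≠ H - 2 := fun e => hy.1 ⟨e, rfl⟩
    simp [model, rew, lab, h1]
  · simp [model, rew, lab]

/-- Data sets that do not depend on the sign, on average over the keys. -/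
def Blind (H n : ℕ) (D : Fin n × Fin (H - 1) → Obs N × Fin 2 × Obs N) : Prop :=
  (∀ t, ¬ Revealing H t.2 (D t)) ∧ ∀ t t', t ≠ t' → ¬ Clash (D t) (D t')

-- On blind data the tuples involve pairwise disjoint sets of keys, so the average over keys is a
-- product of per-tuple averages, each free of the sign.
omit [NeZero H] in
theorem sum_prod_tup_eq {n : ℕ} (D : Fin n × Fin (H - 1) → Obs N × Fin 2 × Obs N)
    (hD : Blind H n D) :
    ∑ ψ, ∏ t, tup H ε true ψ t.2 (D t) = ∑ ψ, ∏ t, tup H ε false ψ t.2 (D t) := by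
  have hdisj : Pairwise fun t t' : Fin n × Fin (H - 1) =>
      Disjoint (blocks (D t).1 ∪ blocks (D t).2.2) (blocks (D t').1 ∪ blocks (D t').2.2) :=
    fun t t' htt => not_not.1 (hD.2 t t' htt)
  have h1 := fun σ => DependsOn.sum_prod
    (fun t : Fin n × Fin (H - 1) => tup_dependsOn hH hε hε' σ t.2 (D t)) hdisj Finset.univ
  have h2 : ∀ t : Fin n × Fin (H - 1),
      ∑ ψ, tup H ε true ψ t.2 (D t) = ∑ ψ, tup H ε false ψ t.2 (D t) := fun t =>
    sum_tup_eq hH hε hε' t.2 (D t) (not_not.1 fun h => hD.1 t (Or.inr fun h' => h h'.symm))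
  have h3 := (h1 true).trans (Eq.trans (by simp only [h2]) (h1 false).symm)
  refine (ENNReal.mul_right_inj ?_ ?_).1 h3
  · exact pow_ne_zero _ (by simp)
  · exact ENNReal.pow_ne_top (ENNReal.natCast_ne_top _)

-- The estimator receives the same data under both signs, while the targets are `4 * ε` apart.
omit hH hε hε' in
theorem errAt_add_ge {n : ℕ} (est : Kernel (Dataset (Fin H × Obs N) (Fin 2) H n) ℝ)
    [IsMarkovKernel est] (D : Fin n × Fin (H - 1) → Obs N × Fin 2 × Obs N) (hD : Blind H n D) :
    ENNReal.ofReal (4 * ε) ≤ errAt est ε true D + errAt est ε false D := by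
  have hemb : (fun k h => embTuple H N ε true h (D (k, h))) =
      fun k h => embTuple H N ε false h (D (k, h)) := by
    funext k h
    simp only [embTuple, reward_eq_of_not_revealing h _ (hD.1 (k, h))]
  rw [errAt, errAt, hemb, ← lintegral_add_left (by fun_prop)]
  calc ENNReal.ofReal (4 * ε) = ∫⁻ _, ENNReal.ofReal (4 * ε)
        ∂(est fun k h => embTuple H N ε false h (D (k, h))) := by simp
    _ ≤ _ := by
      refine lintegral_mono fun v => ?_
      rw [← ENNReal.ofReal_add (abs_nonneg _) (abs_nonneg _)]
      refine ENNReal.ofReal_le_ofReal ?_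
      have h1 := neg_abs_le (v - sgn true * (2 * ε))
      have h2 := le_abs_self (v - sgn false * (2 * ε))
      simp only [sgn, if_true, Bool.false_eq_true, if_false] at *
      linarith

omit [NeZero H] in
theorem one_le_sum_blind_add (n : ℕ)
    [DecidablePred (Blind H n : (Fin n × Fin (H - 1) → Obs N × Fin 2 × Obs N) → Prop)] :
    1 ≤ (∑ D : Fin n × Fin (H - 1) → Obs N × Fin 2 × Obs N with Blind H n D,
        ∏ t, tup H ε σ ψ t.2 (D t)) +
      ENNReal.ofReal (n * (12 * ε * (1 / 2) ^ (H - 2)) + n * H / (N + 1) +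
        (n * H) ^ 2 * (4 / (N + 1))) := by
  have h1 := one_le_sum_prod_add (fun t : Fin n × Fin (H - 1) => tup H ε σ ψ t.2)
    (fun t => Revealing H t.2) Clash (Blind H n) (fun D h h' => ⟨h, h'⟩) _ _
    (fun t => toMeasure_revealing_le hH hε hε' σ ψ t.2)
    (fun t y' => toMeasure_clash_le σ ψ t.2 y')
  refine h1.trans (add_le_add_right ?_ _)
  have hN : (0 : ℝ) < N + 1 := by positivity
  have hp : (0 : ℝ) ≤ 12 * ε * (1 / 2) ^ (H - 2) := by positivity
  have hHle : ((H - 1 : ℕ) : ℝ) ≤ H := by exact_mod_cast Nat.sub_le H 1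
  have hcard : ((Fintype.card (Fin n × Fin (H - 1)) : ℕ) : ℝ≥0∞) =
      ENNReal.ofReal (n * (H - 1 : ℕ)) := by
    rw [← Nat.cast_mul, ENNReal.ofReal_natCast]
    simp
  rw [hcard, ← ENNReal.ofReal_sum_of_nonneg fun t _ => by split_ifs <;> positivity,
    ← ENNReal.ofReal_pow (by positivity), ← ENNReal.ofReal_mul (by positivity),
    ← ENNReal.ofReal_add (Finset.sum_nonneg fun t _ => by split_ifs <;> positivity)
      (by positivity)]
  refine ENNReal.ofReal_le_ofReal (add_le_add ?_ (by gcongr))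
  rw [Finset.sum_add_distrib]
  refine add_le_add ?_ ?_
  · have hlayer : ∑ h : Fin (H - 1), (if (h : ℕ) = H - 2 then 12 * ε * (1 / 2) ^ (H - 2) else 0) ≤
        12 * ε * (1 / 2) ^ (H - 2) := by
      rw [Fin.sum_univ_eq_sum_range
        (fun i => if i = H - 2 then 12 * ε * (1 / 2) ^ (H - 2) else 0) (H - 1), Finset.sum_ite_eq']
      split_ifs
      · exact le_rfl
      · exact hp
    rw [Fintype.sum_prod_type]
    exact (Finset.sum_le_sum fun _ _ => hlayer).trans_eq (by simp)
  · simp only [Finset.sum_const, Finset.card_univ, Fintype.card_prod, Fintype.card_fin,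
      nsmul_eq_mul]
    push_cast
    rw [mul_one_div]
    gcongr

/-- No estimator is accurate on all problems of the class, if the number of samples is small. -/
theorem not_forall_expectedError_le {n : ℕ}
    (hn : n * (12 * ε * (1 / 2) ^ (H - 2)) + n * H / (N + 1) +
      ((n : ℝ) * H) ^ 2 * (4 / (N + 1)) ≤ 1 / 4)
    (est : Kernel (Dataset (Fin H × Obs N) (Fin 2) H n) ℝ) [IsMarkovKernel est] :
    ¬ ∀ σ (ψ : Fin (N + 1) → Bool),
      (prob hH ε σ ψ).expectedError est ≤ ENNReal.ofReal ε := by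
  classical
  intro hest
  set C : ℝ≥0∞ := (Fintype.card (Fin (N + 1) → Bool) : ℝ≥0∞) with hC
  have hC0 : C ≠ 0 := by simp [hC]
  have hCt : C ≠ ∞ := ENNReal.natCast_ne_top _
  set w : Bool → (Fin n × Fin (H - 1) → Obs N × Fin 2 × Obs N) → ℝ≥0∞ :=
    fun σ D => ∑ ψ, ∏ t, tup H ε σ ψ t.2 (D t) with hw
  have hsum : ∀ σ, ∑ D with Blind H n D, w σ D * errAt est ε σ D ≤ C * ENNReal.ofReal ε := by
    intro σ
    calc _ ≤ ∑ D, w σ D * errAt est ε σ D :=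
          Finset.sum_le_sum_of_subset (Finset.filter_subset _ _)
      _ = ∑ ψ, (prob hH ε σ ψ).expectedError est := by
          simp only [hw, expectedError_prob hH hε hε', Finset.sum_mul]
          rw [Finset.sum_comm]
      _ ≤ ∑ _ψ : Fin (N + 1) → Bool, ENNReal.ofReal ε := Finset.sum_le_sum fun ψ _ => hest σ ψ
      _ = _ := by rw [Finset.sum_const, Finset.card_univ, nsmul_eq_mul]
  have hmass : C ≤ (∑ D with Blind H n D, w true D) + C * ENNReal.ofReal (1 / 4) := by
    calc C = ∑ _ψ : Fin (N + 1) → Bool, (1 : ℝ≥0∞) := by simp [hC]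
      _ ≤ ∑ ψ : Fin (N + 1) → Bool, ((∑ D with Blind H n D, ∏ t, tup H ε true ψ t.2 (D t)) +
          ENNReal.ofReal (1 / 4)) := Finset.sum_le_sum fun ψ _ =>
            (one_le_sum_blind_add hH hε hε' true ψ n).trans
              (add_le_add_right (ENNReal.ofReal_le_ofReal hn) _)
      _ = _ := by
          rw [Finset.sum_add_distrib, Finset.sum_comm, Finset.sum_const, Finset.card_univ,
            nsmul_eq_mul]
  have hlow : (∑ D with Blind H n D, w true D) * ENNReal.ofReal (4 * ε) ≤
      C * ENNReal.ofReal (2 * ε) := by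
    calc _ ≤ ∑ D with Blind H n D, (w true D * errAt est ε true D +
          w false D * errAt est ε false D) := by
          rw [Finset.sum_mul]
          refine Finset.sum_le_sum fun D hD => ?_
          have hB := (Finset.mem_filter.1 hD).2
          have hw' : w false D = w true D := (sum_prod_tup_eq hH hε hε' D hB).symm
          rw [hw', ← mul_add]
          gcongr
          exact errAt_add_ge est D hB
      _ ≤ C * ENNReal.ofReal ε + C * ENNReal.ofReal ε := by
          rw [Finset.sum_add_distrib]
          exact add_le_add (hsum true) (hsum false)
      _ = _ := by rw [← mul_add, ← ENNReal.ofReal_add hε.le hε.le, two_mul]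
  -- Blind data cost at most `2 * ε` by `hlow`; the remaining quarter of the mass accounts for at
  -- most another `ε`.
  have hfin : C * ENNReal.ofReal (4 * ε) ≤ C * ENNReal.ofReal (3 * ε) := by
    calc C * ENNReal.ofReal (4 * ε) ≤ ((∑ D with Blind H n D, w true D) +
          C * ENNReal.ofReal (1 / 4)) * ENNReal.ofReal (4 * ε) := by gcongr
      _ ≤ C * ENNReal.ofReal (2 * ε) + C * ENNReal.ofReal (1 / 4) * ENNReal.ofReal (4 * ε) := by
          rw [add_mul]
          gcongr
      _ = _ := by
          rw [mul_assoc, ← ENNReal.ofReal_mul (by norm_num), ← mul_add,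
            ← ENNReal.ofReal_add (by positivity) (by positivity)]
          congr 2
          ring
  have h4 := (ENNReal.mul_le_mul_iff_right hC0 hCt).1 hfin
  rw [ENNReal.ofReal_le_ofReal_iff (by positivity)] at h4
  linarith

end

/-! ### Number of blocks and final sample size bounds -/

theorem half_pow_sub_two_le (H : ℕ) : ((1 : ℝ) / 2) ^ (H - 2) ≤ 4 / 2 ^ H := by
  rw [one_div, inv_pow, le_div_iff₀ (by positivity), inv_mul_le_iff₀ (by positivity)]
  have h1 : (2 : ℝ) ^ H ≤ 2 ^ (H - 2 + 2) := pow_le_pow_right₀ (by norm_num) (by omega)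
  rw [pow_add] at h1
  linarith

/-- For small sample sizes, the probability of an informative data set is small if there are many
blocks. -/
theorem exists_forall_lt_le_quarter (H : ℕ) {ε : ℝ} (hε : 0 < ε) :
    ∃ N : ℕ, ∀ n : ℕ, (n : ℝ) < 2 ^ H / (384 * ε) →
      n * (12 * ε * (1 / 2) ^ (H - 2)) + n * H / (N + 1) +
        ((n : ℝ) * H) ^ 2 * (4 / (N + 1)) ≤ 1 / 4 := by
  set B : ℝ := 2 ^ H / (384 * ε) * H with hB
  have hB0 : 0 ≤ B := by positivity
  -- `B` bounds the number of tuples, so this many blocks keep the collision terms below `1 / 8`;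
  -- the other `1 / 8` is `12 * 4 / 384`.
  obtain ⟨N, hN⟩ := exists_nat_ge (8 * (B + 4 * B ^ 2))
  refine ⟨N, fun n hn => ?_⟩
  have hN0 : (0 : ℝ) < N + 1 := by positivity
  have h1 : (n : ℝ) * H ≤ B := by rw [hB]; gcongr
  have h2 : (n : ℝ) * (12 * ε * (1 / 2) ^ (H - 2)) ≤ 1 / 8 := by
    calc (n : ℝ) * (12 * ε * (1 / 2) ^ (H - 2)) ≤
          2 ^ H / (384 * ε) * (12 * ε * (4 / 2 ^ H)) := by
          gcongr
          exact half_pow_sub_two_le H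
      _ = 1 / 8 := by
          field_simp
          norm_num
  have h3 : (n : ℝ) * H / (N + 1) + ((n : ℝ) * H) ^ 2 * (4 / (N + 1)) ≤ 1 / 8 := by
    calc _ ≤ B / (N + 1) + B ^ 2 * (4 / (N + 1)) := by gcongr
      _ = (B + 4 * B ^ 2) / (N + 1) := by ring
      _ ≤ 1 / 8 := by
          rw [div_le_iff₀ hN0]
          linarith
  linarith

/-- The logarithm is at least `H / 2`, so a single power of it absorbs the factor `H`. -/
theorem div_log_le {H : ℕ} (hH : 1 ≤ H) {ε : ℝ} (hε : 0 < ε) (hε' : ε ≤ 1 / 15) {n : ℝ}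
    (hn : 2 ^ H / (384 * ε) ≤ n) :
    1 / 768 * ((H : ℝ) * 2 ^ H / ε) / Real.log ((H : ℝ) * 2 ^ H / ε) ^ 1 ≤ n := by
  have hH1 : (1 : ℝ) ≤ H := by exact_mod_cast hH
  have h2 : (2 : ℝ) ^ H ≤ (H : ℝ) * 2 ^ H / ε := by
    rw [le_div_iff₀ hε]
    have : (0 : ℝ) < 2 ^ H := by positivity
    nlinarith
  have hlog : (H : ℝ) / 2 ≤ Real.log ((H : ℝ) * 2 ^ H / ε) := by
    refine le_trans ?_ (Real.log_le_log (by positivity) h2)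
    rw [Real.log_pow]
    have := Real.log_two_gt_d9
    nlinarith
  rw [pow_one]
  calc _ ≤ 1 / 768 * ((H : ℝ) * 2 ^ H / ε) / ((H : ℝ) / 2) := by gcongr
    _ = 2 ^ H / (384 * ε) := by
        field_simp
        norm_num
    _ ≤ n := hn

theorem two_rpow_le {H : ℕ} (hH : 10 ≤ H) {ε : ℝ} (hε : 0 < ε) (hε' : ε ≤ 1 / 15) {n : ℝ}
    (hn : 2 ^ H / (384 * ε) ≤ n) : (2 : ℝ) ^ (1 / 2 * (H : ℝ)) ≤ n := by
  have hH1 : (10 : ℝ) ≤ H := by exact_mod_cast hH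
  -- The shift by `5` works because `384 / 15 < 2 ^ 5`, and `H / 2 ≤ H - 5` needs `H ≥ 10`.
  calc (2 : ℝ) ^ (1 / 2 * (H : ℝ)) ≤ (2 : ℝ) ^ ((H : ℝ) - (5 : ℕ)) :=
        Real.rpow_le_rpow_of_exponent_le (by norm_num) (by push_cast; linarith)
    _ = 2 ^ H / 2 ^ 5 := by
        rw [Real.rpow_sub (by norm_num), Real.rpow_natCast, Real.rpow_natCast]
    _ ≤ 2 ^ H / (384 * ε) := by
        gcongr
        linarith
    _ ≤ n := hn

end HardOPE

open HardOPE in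
theorem mainTheorem2 :
    ∃ (c : ℝ) (k : ℕ) (c' : ℝ) (H₀ : ℕ), 0 < c ∧ 0 < c' ∧
      ∀ (ε : ℝ) (H : ℕ), 0 < ε → ε ≤ 1 / 15 → 1 ≤ H →
        ∃ (X : Type) (_ : Fintype X) (_ : MeasurableSpace X) (_ : DiscreteMeasurableSpace X)
          (layer : X → Fin H) (F : Set ((X → Fin 2 → ℝ) × (Fin H → ℝ)))
          (G : Set (OPEProblem X (Fin 2) H)),
          F.ncard = 2 ∧ (Prod.fst '' F).ncard = 2 ∧
          (∀ g ∈ G,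
            g.M.layer = layer ∧ (∀ x, g.πe x = 0) ∧ g.F = F ∧
            g.Realizable ∧ g.Admissible ∧
            (2 ≤ H → ∀ x a, (g.M.layer x : ℕ) + 1 = H → g.M.meanReward x a = 0) ∧
            ∀ π : Policy X (Fin 2),
              g.M.concentrability g.μ π ≤ ENNReal.ofReal (384 * (H : ℝ) ^ 3)) ∧
          ∀ (n : ℕ) (est : Kernel (Dataset X (Fin 2) H n) ℝ), IsMarkovKernel est →
            (∀ g ∈ G, g.expectedError est ≤ ENNReal.ofReal ε) →
              c * ((H : ℝ) * 2 ^ H / ε) / Real.log ((H : ℝ) * 2 ^ H / ε) ^ k ≤ (n : ℝ) ∧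
              (H₀ ≤ H → (2 : ℝ) ^ (c' * (H : ℝ)) ≤ (n : ℝ)) := by
  refine ⟨1 / 768, 1, 1 / 2, 10, by norm_num, by norm_num, fun ε H hε hε' hH => ?_⟩
  have : NeZero H := ⟨by omega⟩
  obtain ⟨N, hN⟩ := exists_forall_lt_le_quarter H hε
  refine ⟨Fin H × Obs N, inferInstance, inferInstance, inferInstance, Prod.fst, funClass N H ε,
    {g | ∃ σ ψ, g = prob hH ε σ ψ}, ncard_funClass hH, ncard_fst_funClass hH, ?_, ?_⟩
  · rintro _ ⟨σ, ψ, rfl⟩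
    exact ⟨rfl, fun _ => rfl, rfl, realizable_prob hH hε hε' σ ψ,
      LatentModel.blockOPE_admissible _ _ _ _ _, meanReward_prob_last hH σ ψ,
      concentrability_prob hH hε hε' σ ψ⟩
  · intro n est hest herr
    have hn : 2 ^ H / (384 * ε) ≤ (n : ℝ) := by
      by_contra hlt
      exact not_forall_expectedError_le hH hε hε' (hN n (not_le.1 hlt)) est
        fun σ ψ => herr _ ⟨σ, ψ, rfl⟩
    exact ⟨div_log_le hH hε hε' hn, fun h10 => two_rpow_le h10 hε hε' hn⟩
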